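/- Let $n$ be a natural number, let $\alpha>n$ be real, and let $\mathbb{B}^n$ be the open Euclidean unit ball of $\mathbb{C}^n$. Let $L^2_{a,\alpha}(\mathbb{B}^n)$ be the reproducing kernel Hilbert space of functions on $\mathbb{B}^n$ with kernel $g(z,w)=\bigl(1-\sum_{i=1}^n z_i\bar w_i\bigr)^{-\alpha}$ (principal branch). Let $\mathcal{E}$ be a complex Hilbert space; regard the Hilbert space tensor product $L^2_{a,\alpha}(\mathbb{B}^n)\otimes\mathcal{E}$ as the reproducing kernel Hilbert space of $\mathcal{E}$-valued functions on $\mathbb{B}^n$ with kernel $g(z,w)I_{\mathcal{E}}$, where $f\otimes\eta$ is the function $z\mapsto f(z)\eta$. Let $\varphi\in H^\infty_{B(\mathcal{E})}(\mathbb{B}^n)$, that is, $\varphi:\mathbb{B}^n\to B(\mathcal{E})$ is bounded and holomorphic, and let $\mathcal{S}$ be a submodule of $L^2_{a,\alpha}(\mathbb{B}^n)\otimes\mathcal{E}$, that is, a closed subspace with $z_j\mathcal{S}\subseteq\mathcal{S}$ for $j=1,\dots,n$. Then: (i) $\varphi F\in L^2_{a,\alpha}(\mathbb{B}^n)\otimes\mathcal{E}$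 for every $F\in L^2_{a,\alpha}(\mathbb{B}^n)\otimes\mathcal{E}$, and the multiplication operator $M_\varphi F=\varphi F$ is an isometry if and only if $M_\varphi=I_{L^2_{a,\alpha}(\mathbb{B}^n)}\otimes V$ for some isometry $V\in B(\mathcal{E})$. (ii) $\mathcal{S}$ is unitarily equivalent to $L^2_{a,\alpha}(\mathbb{B}^n)\otimes\mathcal{E}$ (that is, there is a unitary $U:\mathcal{S}\to L^2_{a,\alpha}(\mathbb{B}^n)\otimes\mathcal{E}$ with $UM_{z_j}|_{\mathcal{S}}=M_{z_j}U$ for $j=1,\dots,n$) if and only if $\mathcal{S}=L^2_{a,\alpha}(\mathbb{B}^n)\otimes\tilde{\mathcal{E}}$ for some closed subspace $\tilde{\mathcal{E}}$ of $\mathcal{E}$ that is isometrically isomorphic to $\mathcal{E}$ (equivalently, $\dim\tilde{\mathcal{E}}=\dim\mathcal{E}$ as Hilbert space dimensions). -/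

import Mathlib

open scoped TensorProduct

/-! ### Multipliers, modules and unitary equivalence -/

section Multipliers

variable {X E : Type*} [NormedAddCommGroup E] [InnerProductSpace ℂ E]

/-- `φ` is a multiplier of the reproducing kernel Hilbert space `H` of `E`-valued functions:
`φ F ∈ H` for every `F ∈ H`. -/
def IsMultiplier (H : Type*) [NormedAddCommGroup H] [InnerProductSpace ℂ H] [RKHS ℂ H X E]
    (φ : X → E →L[ℂ] E) : Prop :=
  ∀ F : H, ∃ G : H, ∀ x, G x = φ x (F x)

variable {H : Type*} [NormedAddCommGroup H] [InnerProductSpace ℂ H] [RKHS ℂ H X E]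

/-- The multiplication operator `M_φ F = φ F` of a multiplier `φ`. -/
noncomputable def mulOp (φ : X → E →L[ℂ] E) (hφ : IsMultiplier H φ) : H →ₗ[ℂ] H where
  toFun F := (hφ F).choose
  map_add' F G := RKHS.ext fun x => by
    refine ((hφ (F + G)).choose_spec x).trans ?_
    rw [RKHS.coe_add, RKHS.coe_add, Pi.add_apply, Pi.add_apply, (hφ F).choose_spec,
      (hφ G).choose_spec, map_add]
  map_smul' c F := RKHS.ext fun x => by
    refine ((hφ (c • F)).choose_spec x).trans ?_
    rw [RingHom.id_apply, RKHS.coe_smul, RKHS.coe_smul, Pi.smul_apply, Pi.smul_apply,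
      (hφ F).choose_spec, map_smul]

theorem mulOp_apply (φ : X → E →L[ℂ] E) (hφ : IsMultiplier H φ) (F : H) (x : X) :
    mulOp φ hφ F x = φ x (F x) :=
  (hφ F).choose_spec x

/-- A linear subspace of a reproducing kernel Hilbert space, as a space of functions. -/
noncomputable instance instRKHSSubmodule (S : Submodule ℂ H) : RKHS ℂ S X E where
  coeCLM := (RKHS.coeCLM ℂ : H →L[ℂ] X → E) ∘L S.subtypeL
  coeCLM_injective := RKHS.coeCLM_injective.comp Subtype.val_injective

theorem submodule_coe_apply (S : Submodule ℂ H) (F : S) (x : X) : F x = (F : H) x := rfl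

end Multipliers

section Modules

variable {n : ℕ} {Ω : Set (EuclideanSpace ℂ (Fin n))}

/-- The coordinate function `z ↦ z_j`, acting on `E`-valued functions. -/
noncomputable def coordFun (E : Type*) [NormedAddCommGroup E] [InnerProductSpace ℂ E]
    (j : Fin n) (z : Ω) : E →L[ℂ] E :=
  z.1 j • ContinuousLinearMap.id ℂ E

/-- `H` is a reproducing kernel Hilbert module over `ℂ[z₁, …, zₙ]`: `z_j H ⊆ H` for all `j`. -/
def IsHilbertModule {E : Type*} [NormedAddCommGroup E] [InnerProductSpace ℂ E]
    (H : Type*) [NormedAddCommGroup H] [InnerProductSpace ℂ H] [RKHS ℂ H Ω E] : Prop :=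
  ∀ j, IsMultiplier H (coordFun (Ω := Ω) E j)

/-- A submodule: a closed subspace `S` of `H` with `z_j S ⊆ S` for all `j`. -/
def IsHilbertSubmodule {E : Type*} [NormedAddCommGroup E] [InnerProductSpace ℂ E]
    {H : Type*} [NormedAddCommGroup H] [InnerProductSpace ℂ H] [RKHS ℂ H Ω E]
    (S : Submodule ℂ H) : Prop :=
  IsClosed (S : Set H) ∧ IsHilbertModule S

/-- Unitary equivalence of reproducing kernel Hilbert modules: there is a unitary `U` with
`U M_{z_j} = M_{z_j} U` for all `j`. -/
def UnitarilyEquivalent {E₁ E₂ : Type*} [NormedAddCommGroup E₁] [InnerProductSpace ℂ E₁]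
    [NormedAddCommGroup E₂] [InnerProductSpace ℂ E₂]
    (H₁ H₂ : Type*) [NormedAddCommGroup H₁] [InnerProductSpace ℂ H₁] [RKHS ℂ H₁ Ω E₁]
    [NormedAddCommGroup H₂] [InnerProductSpace ℂ H₂] [RKHS ℂ H₂ Ω E₂] : Prop :=
  ∃ (h₁ : IsHilbertModule H₁) (h₂ : IsHilbertModule H₂) (U : H₁ ≃ₗᵢ[ℂ] H₂),
    ∀ j F, U (mulOp _ (h₁ j) F) = mulOp _ (h₂ j) (U F)

end Modules

/-! ### Hilbert space tensor products -/

section Tensor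

variable (H E : Type*) [NormedAddCommGroup H] [InnerProductSpace ℂ H]
  [NormedAddCommGroup E] [InnerProductSpace ℂ E]

/-- The Hilbert space tensor product of `H` and `E`: the completion of the algebraic tensor product
for the inner product with `⟪f ⊗ η, g ⊗ ξ⟫ = ⟪f, g⟫ ⟪η, ξ⟫`. -/
abbrev HilbertTensor : Type _ := UniformSpace.Completion (H ⊗[ℂ] E)

variable {E}

/-- The operator `I_H ⊗ V`. -/
noncomputable def idTensor (V : E →L[ℂ] E) : HilbertTensor H E →L[ℂ] HilbertTensor H E :=
  (V.lTensor H).completion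

/-- The closed subspace `H ⊗ E'` of `H ⊗ E`, for a subspace `E'` of `E`. -/
noncomputable def tensorSubspace (E' : Submodule ℂ E) : Submodule ℂ (HilbertTensor H E) :=
  (Submodule.span ℂ
    {F | ∃ f : H, ∃ η ∈ E', F = ((f ⊗ₜ[ℂ] η : H ⊗[ℂ] E) : HilbertTensor H E)}).topologicalClosure

variable {X : Type*} [RKHS ℂ H X ℂ] [CompleteSpace E]

variable (E) in
/-- Evaluation at `x` on `H ⊗ E`: the continuous linear map with `f ⊗ η ↦ f x • η`. -/
noncomputable def tensorEval (x : X) : HilbertTensor H E →L[ℂ] E :=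
  (((TensorProduct.lidIsometry ℂ E).toContinuousLinearEquiv : ℂ ⊗[ℂ] E →L[ℂ] E) ∘L
    (ContinuousLinearMap.proj x ∘L (RKHS.coeCLM ℂ : H →L[ℂ] X → ℂ)).rTensor E).fromCompletion

theorem tensorEval_tmul (x : X) (f : H) (η : E) :
    tensorEval H E x ((f ⊗ₜ[ℂ] η : H ⊗[ℂ] E) : HilbertTensor H E) = f x • η := by
  simp [tensorEval]

variable {H}

theorem inner_kerFun_tmul [CompleteSpace H] (x : X) (η : E) (F : HilbertTensor H E) :
    inner ℂ ((RKHS.kerFun H x 1 ⊗ₜ[ℂ] η : H ⊗[ℂ] E) : HilbertTensor H E) F =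
      inner ℂ η (tensorEval H E x F) := by
  induction F using UniformSpace.Completion.induction_on with
  | hp => exact isClosed_eq (by fun_prop) (by fun_prop)
  | ih F =>
    induction F using TensorProduct.induction_on with
    | zero =>
      rw [UniformSpace.Completion.coe_zero, inner_zero_right, map_zero, inner_zero_right]
    | tmul f ξ => simp [tensorEval_tmul]
    | add F G hF hG =>
      rw [UniformSpace.Completion.coe_add, inner_add_right, map_add, inner_add_right, hF, hG]

theorem eq_zero_of_tensorEval [CompleteSpace H] {F : HilbertTensor H E}
    (h : ∀ x, tensorEval H E x F = 0) : F = 0 := by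
  refine UniformSpace.Completion.denseRange_coe.eq_zero_of_inner_right ℂ fun G => ?_
  induction G using TensorProduct.induction_on with
  | zero => rw [UniformSpace.Completion.coe_zero, inner_zero_left]
  | add G₁ G₂ h₁ h₂ => rw [UniformSpace.Completion.coe_add, inner_add_left, h₁, h₂, add_zero]
  | tmul f η =>
    let T : H →L[ℂ] HilbertTensor H E :=
      (UniformSpace.Completion.toComplL (𝕜 := ℂ)) ∘L (TensorProduct.mkL ℂ H E).flip η
    have hT : ∀ g, T g = ((g ⊗ₜ[ℂ] η : H ⊗[ℂ] E) : HilbertTensor H E) := fun g => rfl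
    let p : Submodule ℂ H :=
      { carrier := {g | inner ℂ (T g) F = 0}
        zero_mem' := by simp
        add_mem' := fun {a b} ha hb => by
          simp only [Set.mem_ofPred_eq] at *; rw [map_add, inner_add_left, ha, hb, add_zero]
        smul_mem' := fun c a ha => by
          simp only [Set.mem_ofPred_eq] at *; rw [map_smul, inner_smul_left, ha, mul_zero] }
    have hp : IsClosed (p : Set H) := isClosed_eq (by fun_prop) continuous_const
    have hle : (Submodule.span ℂ {RKHS.kerFun H x v | (x : X) (v : ℂ)}).topologicalClosure ≤ p := by
      refine Submodule.topologicalClosure_minimal _ (Submodule.span_le.2 ?_) hp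
      rintro _ ⟨x, v, rfl⟩
      have : RKHS.kerFun H x v = v • RKHS.kerFun H x 1 := by rw [← map_smul]; simp
      rw [this]
      refine p.smul_mem _ ?_
      change inner ℂ (T _) F = 0
      rw [hT, inner_kerFun_tmul, h, inner_zero_right]
    rw [RKHS.kerFun_dense] at hle
    exact hle (Submodule.mem_top (x := f))

/-- `H ⊗ E` as a reproducing kernel Hilbert space of `E`-valued functions, with `f ⊗ η` being the
function `x ↦ f x • η`. -/
noncomputable instance instRKHSHilbertTensor [CompleteSpace H] : RKHS ℂ (HilbertTensor H E) X E where
  coeCLM := .pi (tensorEval H E)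
  coeCLM_injective := (injective_iff_map_eq_zero _).2 fun _ h =>
    eq_zero_of_tensorEval fun x => congrFun h x

theorem hilbertTensor_coe_tmul [CompleteSpace H] (f : H) (η : E) (x : X) :
    ((f ⊗ₜ[ℂ] η : H ⊗[ℂ] E) : HilbertTensor H E) x = f x • η :=
  tensorEval_tmul H x f η

/-- The kernel of `H ⊗ E` is `k I_E`, where `k` is the scalar kernel of `H`. -/
theorem kernel_hilbertTensor [CompleteSpace H] (x y : X) :
    RKHS.kernel (HilbertTensor H E) x y =
      RKHS.kernel H x y 1 • ContinuousLinearMap.id ℂ E := by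
  ext η
  refine ext_inner_right ℂ fun ξ => ?_
  have h1 : RKHS.kerFun (HilbertTensor H E) y η =
      ((RKHS.kerFun H y 1 ⊗ₜ[ℂ] η : H ⊗[ℂ] E) : HilbertTensor H E) := by
    refine ext_inner_right ℂ fun F => ?_
    rw [inner_kerFun_tmul, RKHS.kerFun_inner]; rfl
  rw [← RKHS.kerFun_apply, h1, hilbertTensor_coe_tmul, RKHS.kerFun_apply]
  simp

end Tensor

/-! ### Weighted Bergman spaces on the unit ball -/

/-- The open unit ball `𝔹ⁿ` of `ℂⁿ` (Euclidean norm). -/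
abbrev UnitBall (n : ℕ) : Type :=
  Metric.ball (0 : EuclideanSpace ℂ (Fin n)) 1

/-- The scalar kernel `g(z, w) = (1 - ∑ᵢ zᵢ w̄ᵢ) ^ (-α)` on the unit ball (principal branch), as a
matrix of operators on the one-dimensional space `ℂ`.
Mathlib's inner product is conjugate-linear in its first argument, so `inner ℂ w z = ∑ᵢ zᵢ w̄ᵢ`. -/
noncomputable def bergmanKernel (n : ℕ) (α : ℝ) :
    Matrix (UnitBall n) (UnitBall n) (ℂ →L[ℂ] ℂ) :=
  .of fun z w => (1 - inner ℂ w.1 z.1) ^ (-(α : ℂ)) • ContinuousLinearMap.id ℂ ℂ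

theorem binomial_hasSum (α : ℝ) (hα : 0 ≤ α) : ∃ c : ℕ → ℝ, (∀ k, 0 ≤ c k) ∧
    ∀ t : ℂ, ‖t‖ < 1 → HasSum (fun k => (c k : ℂ) * t ^ k) ((1 - t) ^ (-(α : ℂ))) := by
  refine ⟨fun k => (ascPochhammer ℝ k).eval α / k.factorial, fun k => ?_, fun t ht => ?_⟩
  · refine div_nonneg ?_ (by positivity)
    induction k with
    | zero => simp
    | succ k ih => rw [ascPochhammer_succ_eval]; positivity
  · have h := (Complex.one_div_one_sub_cpow_hasFPowerSeriesOnBall_zero (α : ℂ)).hasSum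
      (y := t) (by
        rw [← ENNReal.ofReal_one, Metric.eball_ofReal]; simpa using ht)
    rw [zero_add, one_div, ← Complex.cpow_neg] at h
    refine (congrArg (fun f => HasSum f ((1 - t) ^ (-(α : ℂ)))) (funext fun k => ?_)).mpr h
    have h1 := Ring.factorial_nsmul_multichoose_eq_ascPochhammer (α : ℂ) k
    rw [Polynomial.ascPochhammer_smeval_eq_eval, Ring.multichoose_eq, nsmul_eq_mul] at h1
    have h2 : ((((ascPochhammer ℝ k).eval α : ℝ)) : ℂ) = (ascPochhammer ℂ k).eval (α : ℂ) := by
      have := Polynomial.eval_map_apply (p := ascPochhammer ℝ k) Complex.ofRealHom α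
      rw [ascPochhammer_map] at this
      exact this.symm
    have h3 : (k.factorial : ℂ) ≠ 0 := by exact_mod_cast k.factorial_ne_zero
    rw [FormalMultilinearSeries.ofScalars_apply_eq, smul_eq_mul]
    push_cast
    rw [h2, ← h1, mul_div_cancel_left₀ _ h3]

theorem bergmanKernel_posSemidef (n : ℕ) (α : ℝ) (hα : 0 ≤ α) :
    (bergmanKernel n α).PosSemidef := by
  obtain ⟨c, hc, hs⟩ := binomial_hasSum α hα
  have hlt : ∀ z w : UnitBall n, ‖inner ℂ z.1 w.1‖ < 1 := fun z w => by
    have hz : ‖z.1‖ < 1 := mem_ball_zero_iff.1 z.2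
    have hw : ‖w.1‖ < 1 := mem_ball_zero_iff.1 w.2
    refine (norm_inner_le_norm _ _).trans_lt ?_
    exact mul_lt_one_of_nonneg_of_lt_one_left (norm_nonneg _) hz hw.le
  have hconj : ∀ z w : UnitBall n, star ((1 - inner ℂ w.1 z.1 : ℂ) ^ (-(α : ℂ))) =
      (1 - inner ℂ z.1 w.1 : ℂ) ^ (-(α : ℂ)) := fun z w => by
    refine ((hs _ (hlt w z)).star).unique ?_
    convert hs _ (hlt z w) using 2 with k
    simp
  suffices h : (bergmanKernel n α).IsHermitian ∧ ∀ v : UnitBall n →₀ ℂ, 0 ≤ RCLike.re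
      (v.sum fun x w => v.sum fun y w' => inner ℂ (bergmanKernel n α y x w) w') from
    (RKHS.posSemidef_tfae.out 0 2).2 h
  refine ⟨?_, fun v => ?_⟩
  · ext z w
    simp only [Matrix.conjTranspose_apply, bergmanKernel, Matrix.of_apply, star_smul]
    rw [hconj]
    simp [ContinuousLinearMap.star_eq_adjoint, ContinuousLinearMap.adjoint_id]
  · have key : HasSum (fun k => (c k : ℂ) * ∑ x ∈ v.support, ∑ y ∈ v.support,
        (inner ℂ y.1 x.1) ^ k * ((starRingEnd ℂ) (v x) * v y))
        (v.sum fun x w => v.sum fun y w' => inner ℂ (bergmanKernel n α y x w) w') := by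
      simp only [Finsupp.sum, Finset.mul_sum]
      refine hasSum_sum fun x _ => hasSum_sum fun y _ => ?_
      have : inner ℂ (bergmanKernel n α y x (v x)) (v y) =
          (1 - inner ℂ y.1 x.1 : ℂ) ^ (-(α : ℂ)) * ((starRingEnd ℂ) (v x) * v y) := by
        rw [← hconj]
        simp [bergmanKernel]
        ring
      rw [this]
      simpa [mul_assoc] using (hs _ (hlt y x)).mul_right ((starRingEnd ℂ) (v x) * v y)
    refine (Complex.hasSum_re key).nonneg fun k => ?_
    have expand : ∑ x ∈ v.support, ∑ y ∈ v.support,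
        (inner ℂ y.1 x.1) ^ k * ((starRingEnd ℂ) (v x) * v y) =
        ∑ p : Fin k → Fin n, (starRingEnd ℂ) (∑ x ∈ v.support,
          v x * ∏ i, (starRingEnd ℂ) (x.1 (p i))) *
          ∑ x ∈ v.support, v x * ∏ i, (starRingEnd ℂ) (x.1 (p i)) := by
      have hpow : ∀ x y : UnitBall n, (inner ℂ y.1 x.1 : ℂ) ^ k =
          ∑ p : Fin k → Fin n, (∏ i, x.1 (p i)) * ∏ i, (starRingEnd ℂ) (y.1 (p i)) := by
        intro x y
        rw [PiLp.inner_apply, Finset.sum_pow', Fintype.piFinset_univ]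
        simp [Finset.prod_mul_distrib]
      simp only [hpow, Finset.sum_mul, map_sum, Finset.mul_sum, map_mul, map_prod,
        Complex.conj_conj]
      rw [Finset.sum_comm]
      refine (Finset.sum_congr rfl fun y _ => Finset.sum_comm).trans ?_
      rw [Finset.sum_comm]
      refine Finset.sum_congr rfl fun p _ => Finset.sum_congr rfl fun y _ =>
        Finset.sum_congr rfl fun x _ => ?_
      ring
    rw [expand, Complex.re_ofReal_mul, Complex.re_sum]
    refine mul_nonneg (hc k) (Finset.sum_nonneg fun p _ => ?_)
    rw [← Complex.normSq_eq_conj_mul_self, Complex.ofReal_re]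
    exact Complex.normSq_nonneg _

instance instFactBergmanKernel (n : ℕ) (α : ℝ) [h : Fact ((n : ℝ) < α)] :
    Fact (bergmanKernel n α).PosSemidef :=
  ⟨bergmanKernel_posSemidef n α ((Nat.cast_nonneg n).trans h.out.le)⟩

/-- The weighted Bergman space `L²_{a,α}(𝔹ⁿ)`, `α > n`: the reproducing kernel Hilbert space of
scalar functions on the unit ball with kernel `(1 - ⟨z, w⟩) ^ (-α)`. -/
abbrev WeightedBergman (n : ℕ) (α : ℝ) [Fact ((n : ℝ) < α)] : Type :=
  RKHS.OfKernel (bergmanKernel n α)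

/-- `φ ∈ H^∞_{B(E)}(𝔹ⁿ)`: a bounded holomorphic `B(E)`-valued function on the unit ball
(values of `φ` outside the ball are irrelevant). -/
def IsBoundedHolomorphic {n : ℕ} {E : Type*} [NormedAddCommGroup E] [InnerProductSpace ℂ E]
    (φ : EuclideanSpace ℂ (Fin n) → E →L[ℂ] E) : Prop :=
  DifferentiableOn ℂ φ (Metric.ball 0 1) ∧ ∃ C : ℝ, ∀ z ∈ Metric.ball 0 1, ‖φ z‖ ≤ C

/-! Since α > n, the normalised weight `(1 - |z|²)^(α-n-1)` (a point mass if n = 0) gives a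
probability measure μ on the ball that is unitarily invariant and reproduces every bounded
holomorphic function against the kernel (`IsBergmanMeasure.integral_mul_kernel`). Hence finite
kernel sums have as norm their L²(μ) norm, and every bounded holomorphic `h` belongs to the space
with `‖h‖² ≤ ∫ ‖h‖² dμ` (`IsBergmanMeasure.exists_eq_of_bounded`). For kernel sums F this bounds φF
by sup ‖φ‖ · ‖F‖; density then makes φ a multiplier (`exists_mul_eq`).

For (i), let M_φ be isometric. Testing on kernel functions gives ‖φ(z)‖ ≤ 1 (`norm_symbol_le`).
Applying M_φ to the constant function η gives ‖η‖² ≤ ∫ ‖φ(z)η‖² dμ, so ‖φ(z)η‖ attains the value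
‖η‖, its upper bound, inside the ball. The maximum principle in a Hilbert space makes φ(z)η constant
in z (`eq_of_isometry_mulOp`), so M_φ = I ⊗ φ(0). Conversely, I ⊗ V is isometric when V is.

For (ii), a unitary U from S onto the whole module gives an isometry W, the inclusion of S after
U⁻¹, which commutes with the coordinate multiplications. The kernel function at w is a convergent
series in powers of ⟨·, w⟩ applied to constants, so W is determined by its values on constants and
is multiplication by a symbol φ (`exists_symbol_of_commute`). Holomorphy of φ in operator norm
follows by writing evaluation at z as evaluation at 0 after (1 - B z)^(-α), with B z linear in z
(`apply_eq_tsum_apply_zero`). By (i), W = I ⊗ V, so S is its range, which is the tensor product with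
the range of V. Conversely, I ⊗ V is a module isomorphism onto its range. -/

/-! ### Moments of the radial weights on the ball. -/

section BallMeasure

open MeasureTheory Set ProbabilityTheory

/-- The radial weight `(1 - t) ^ β` on `t < 1`, extended by zero. -/
noncomputable def ballWeight (β t : ℝ) : ℝ := if t < 1 then (1 - t) ^ β else 0

theorem ballWeight_nonneg (β t : ℝ) : 0 ≤ ballWeight β t := by
  unfold ballWeight
  split_ifs with h
  · exact Real.rpow_nonneg (by linarith) _
  · exact le_rfl

@[fun_prop]
theorem measurable_ballWeight (β : ℝ) : Measurable (ballWeight β) :=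
  Measurable.ite measurableSet_Iio (by fun_prop) measurable_const

theorem ballWeight_of_one_le {β t : ℝ} (h : 1 ≤ t) : ballWeight β t = 0 := if_neg h.not_gt

/-- Rests on 1 - (a + (1 - a)b) = (1 - a)(1 - b). With a the squared modulus of one coordinate, it
splits that coordinate off the weight. -/
theorem ballWeight_scale {β a b : ℝ} (ha : a < 1) :
    ballWeight β (a + (1 - a) * b) = (1 - a) ^ β * ballWeight β b := by
  have h : a + (1 - a) * b < 1 ↔ b < 1 := by constructor <;> intro h <;> nlinarith
  simp only [ballWeight, h]
  split_ifs with hb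
  · rw [← Real.mul_rpow (by linarith) (by linarith)]
    ring_nf
  · simp

/-- The integrand is an unnormalised beta density, and the normalised one has total mass 1. -/
theorem integral_pow_mul_ballWeight (m : ℕ) {γ : ℝ} (hγ : -1 < γ) :
    ∫ t in Ioi (0 : ℝ), t ^ m * ballWeight γ t = beta (m + 1) (γ + 1) := by
  have hm : (0 : ℝ) < m + 1 := by positivity
  have hb : 0 < beta (m + 1) (γ + 1) := beta_pos hm (by linarith)
  have h1 : ∫ t, betaPDFReal (m + 1) (γ + 1) t = 1 := by
    rw [integral_eq_lintegral_of_nonneg_ae]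
    · exact (ENNReal.toReal_eq_one_iff _).2 (lintegral_betaPDF_eq_one hm (by linarith))
    · refine ae_of_all _ fun t => ?_
      by_cases ht : 0 < t ∧ t < 1
      · exact (betaPDFReal_pos ht.1 ht.2 hm (by linarith)).le
      · simp [betaPDFReal, ht]
    · exact (stronglyMeasurable_betaPDFReal _ _).aestronglyMeasurable
  have h2 : beta (m + 1) (γ + 1) * ∫ t, betaPDFReal (m + 1) (γ + 1) t =
      beta (m + 1) (γ + 1) := by rw [h1, mul_one]
  rw [← integral_indicator measurableSet_Ioi]
  refine Eq.trans ?_ h2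
  rw [← integral_const_mul]
  congr 1 with t
  by_cases ht : 0 < t
  · rw [indicator_of_mem (mem_Ioi.2 ht)]
    by_cases ht' : t < 1
    · simp only [ballWeight, betaPDFReal, ht, ht', and_self, if_true, add_sub_cancel_right,
        Real.rpow_natCast]
      field_simp
    · simp [ballWeight, betaPDFReal, ht']
  · rw [indicator_of_notMem (by simpa using ht)]
    simp [betaPDFReal, ht]

/-- Polar coordinates followed by the substitution t = r². -/
theorem integral_complex_pow_mul_ballWeight (m : ℕ) {γ : ℝ} (hγ : -1 < γ) :
    ∫ z : ℂ, ‖z‖ ^ (2 * m) * ballWeight γ (‖z‖ ^ 2) = Real.pi * beta (m + 1) (γ + 1) := by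
  calc
    _ = ∫ x in Ioi (0 : ℝ) ×ˢ Ioo (-Real.pi) Real.pi,
          x.1 * (|x.1| ^ (2 * m) * ballWeight γ (|x.1| ^ 2)) := by
      rw [← Complex.integral_comp_polarCoord_symm, polarCoord_target]
      simp_rw [Complex.norm_polarCoord_symm, smul_eq_mul]
    _ = (∫ x in Ioi (0 : ℝ), x * (|x| ^ (2 * m) * ballWeight γ (|x| ^ 2))) *
          ∫ _ in Ioo (-Real.pi) Real.pi, 1 := by
      rw [← setIntegral_prod_mul, Measure.volume_eq_prod]
      simp_rw [mul_one]
    _ = Real.pi * ∫ x in Ioi (0 : ℝ),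
          (2 * x ^ ((2 : ℝ) - 1)) • ((fun t : ℝ => t ^ m * ballWeight γ t) (x ^ (2 : ℝ))) := by
      simp_rw [integral_const, measureReal_restrict_apply MeasurableSet.univ, Set.univ_inter,
        Real.volume_real_Ioo_of_le (a := -Real.pi) (b := Real.pi) (by linarith [Real.pi_nonneg]),
        sub_neg_eq_add, smul_eq_mul, mul_one]
      rw [mul_comm, ← two_mul, mul_comm (2 : ℝ), mul_assoc, ← integral_const_mul]
      congr 1
      refine setIntegral_congr_fun measurableSet_Ioi (fun x hx => ?_)
      rw [mem_Ioi] at hx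
      have h2 : ((2 : ℝ) - 1) = 1 := by norm_num
      simp only [h2, Real.rpow_one, Real.rpow_two, sq_abs, pow_mul]
      ring
    _ = _ := congrArg _ ((integral_comp_rpow_Ioi_of_pos two_pos).trans
      (integral_pow_mul_ballWeight m hγ))

theorem lintegral_complex_pow_mul_ballWeight (m : ℕ) {γ : ℝ} (hγ : -1 < γ) :
    ∫⁻ z : ℂ, ENNReal.ofReal (‖z‖ ^ (2 * m) * ballWeight γ (‖z‖ ^ 2)) =
      ENNReal.ofReal (Real.pi * beta (m + 1) (γ + 1)) := by
  have h := integral_complex_pow_mul_ballWeight m hγ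
  have hpos : 0 < Real.pi * beta (m + 1) (γ + 1) :=
    mul_pos Real.pi_pos (beta_pos (by positivity) (by linarith))
  rw [← h, ofReal_integral_eq_lintegral_ofReal]
  -- A non-integrable function would have Bochner integral 0, but the value is positive.
  · by_contra hn
    rw [integral_undef hn] at h
    exact hpos.ne h
  · exact ae_of_all _ fun z => mul_nonneg (by positivity) (ballWeight_nonneg _ _)

theorem lintegral_smul_addHaar {V : Type*} [NormedAddCommGroup V] [NormedSpace ℝ V]
    [MeasurableSpace V] [BorelSpace V] [FiniteDimensional ℝ V] (μ : Measure V)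
    [μ.IsAddHaarMeasure] {f : V → ENNReal} (hf : Measurable f) {r : ℝ} (hr : 0 < r) :
    ∫⁻ x, f x ∂μ = ENNReal.ofReal (r ^ Module.finrank ℝ V) * ∫⁻ x, f (r • x) ∂μ := by
  have h := lintegral_map (μ := μ) hf (measurable_const_smul r)
  rw [Measure.map_addHaar_smul μ hr.ne', lintegral_smul_measure, smul_eq_mul,
    abs_of_pos (by positivity)] at h
  rw [← h, ← mul_assoc, ← ENNReal.ofReal_mul (by positivity),
    mul_inv_cancel₀ (by positivity), ENNReal.ofReal_one, one_mul]

/-- Fix the first coordinate a and rescale the other k by √(1 - |a|²). They have real dimension 2k,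
so the Jacobian is (1 - |a|²)^k, which raises the exponent of the weight in a from β to β + k. -/
theorem lintegral_pi_ballWeight_succ (k m : ℕ) (β : ℝ) :
    ∫⁻ z : Fin (k + 1) → ℂ, ENNReal.ofReal (‖z 0‖ ^ (2 * m) * ballWeight β (∑ i, ‖z i‖ ^ 2)) =
      (∫⁻ z : ℂ, ENNReal.ofReal (‖z‖ ^ (2 * m) * ballWeight (β + k) (‖z‖ ^ 2))) *
        ∫⁻ z : Fin k → ℂ, ENNReal.ofReal (ballWeight β (∑ i, ‖z i‖ ^ 2)) := by
  have hmp := (volume_preserving_piFinSuccAbove (fun _ : Fin (k + 1) => ℂ) 0).symm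
  rw [← hmp.lintegral_comp (by fun_prop), Measure.volume_eq_prod, lintegral_prod _ (by fun_prop)]
  rw [← lintegral_mul_const _ (by fun_prop)]
  congr 1 with a
  simp only [MeasurableEquiv.piFinSuccAbove_symm_apply, Fin.insertNthEquiv, Equiv.coe_fn_mk,
    Fin.insertNth_zero', Fin.cons_zero, Fin.sum_univ_succ, Fin.cons_succ]
  by_cases ha : ‖a‖ ^ 2 < 1
  · have hs : 0 < 1 - ‖a‖ ^ 2 := by linarith
    rw [lintegral_smul_addHaar volume (by fun_prop) (Real.sqrt_pos.2 hs), ← lintegral_const_mul _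
      (by fun_prop), ← lintegral_const_mul _ (by fun_prop)]
    congr 1 with z
    have h1 : ∑ i, ‖(√(1 - ‖a‖ ^ 2) • z) i‖ ^ 2 = (1 - ‖a‖ ^ 2) * ∑ i, ‖z i‖ ^ 2 := by
      rw [Finset.mul_sum]
      refine Finset.sum_congr rfl fun i _ => ?_
      rw [Pi.smul_apply, norm_smul, mul_pow, Real.norm_eq_abs, sq_abs, Real.sq_sqrt hs.le]
    have h2 : √(1 - ‖a‖ ^ 2) ^ Module.finrank ℝ (Fin k → ℂ) = (1 - ‖a‖ ^ 2) ^ (k : ℝ) := by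
      have : Module.finrank ℝ (Fin k → ℂ) = 2 * k := by
        simp [Module.finrank_pi_fintype, Complex.finrank_real_complex, mul_comm]
      rw [this, pow_mul, Real.sq_sqrt hs.le, Real.rpow_natCast]
    rw [h1, h2, ballWeight_scale ha, ← ENNReal.ofReal_mul (by positivity),
      ← ENNReal.ofReal_mul (mul_nonneg (by positivity) (ballWeight_nonneg _ _))]
    congr 1
    rw [ballWeight.eq_1 (β + k), if_pos ha, Real.rpow_add hs]
    ring
  · have h0 : ∀ z : Fin k → ℂ, ballWeight β (‖a‖ ^ 2 + ∑ i, ‖z i‖ ^ 2) = 0 := fun z =>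
      ballWeight_of_one_le ((not_lt.1 ha).trans
        (le_add_of_nonneg_right (Finset.sum_nonneg fun i _ => by positivity)))
    simp [h0, ballWeight_of_one_le (not_lt.1 ha)]

theorem lintegral_pi_ballWeight_pos_lt_top (k : ℕ) {β : ℝ} (hβ : -1 < β) :
    0 < ∫⁻ z : Fin k → ℂ, ENNReal.ofReal (ballWeight β (∑ i, ‖z i‖ ^ 2)) ∧
      ∫⁻ z : Fin k → ℂ, ENNReal.ofReal (ballWeight β (∑ i, ‖z i‖ ^ 2)) < ⊤ := by
  induction k with
  | zero => simp [ballWeight, volume_pi]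
  | succ k ih =>
    have hk : (-1 : ℝ) < β + k := by have : (0 : ℝ) ≤ k := k.cast_nonneg; linarith
    have h := lintegral_pi_ballWeight_succ k 0 β
    rw [lintegral_complex_pow_mul_ballWeight 0 hk] at h
    simp only [mul_zero, pow_zero, one_mul] at h
    rw [h]
    have hpos : 0 < Real.pi * beta ((0 : ℕ) + 1) (β + k + 1) :=
      mul_pos Real.pi_pos (beta_pos (by positivity) (by linarith))
    exact ⟨ENNReal.mul_pos (ENNReal.ofReal_pos.2 hpos).ne' ih.1.ne',
      ENNReal.mul_lt_top ENNReal.ofReal_lt_top ih.2⟩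

end BallMeasure

/-! ### The representing measure and its normalisation. -/

section BallMeasure

open MeasureTheory Set ProbabilityTheory

/-- The image of a Haar measure is a multiple of it, and the unit ball, which is preserved, forces
the factor to be 1. -/
theorem LinearIsometryEquiv.measurePreserving_addHaar {V : Type*} [NormedAddCommGroup V]
    [NormedSpace ℝ V] [MeasurableSpace V] [BorelSpace V] [FiniteDimensional ℝ V] (m : Measure V)
    [m.IsAddHaarMeasure] (L : V ≃ₗᵢ[ℝ] V) : MeasurePreserving L m m := by
  refine ⟨L.continuous.measurable, ?_⟩
  have hH : (m.map L).IsAddHaarMeasure :=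
    L.toContinuousLinearEquiv.isAddHaarMeasure_map m
  have h := Measure.isAddLeftInvariant_eq_smul (m.map L) m
  have hb : m.map L (Metric.ball 0 1) = m (Metric.ball 0 1) := by
    rw [Measure.map_apply L.continuous.measurable measurableSet_ball]
    congr 1
    ext x
    simp
  have h0 : m (Metric.ball 0 1) ≠ 0 := (Metric.measure_ball_pos m _ one_pos).ne'
  have h1 : m (Metric.ball 0 1) ≠ ⊤ := measure_ball_lt_top.ne
  rw [h, Measure.smul_apply, ENNReal.smul_def, smul_eq_mul] at hb
  have hc : ((m.map L).addHaarScalarFactor m : ENNReal) = 1 :=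
    (ENNReal.mul_eq_right h0 h1).1 hb
  rw [h, ENNReal.coe_eq_one.1 hc, one_smul]

/-- The `k`-th Taylor coefficient of `(1 - t) ^ (-α)` at `0`. -/
noncomputable def binomCoeff (α : ℝ) (k : ℕ) : ℝ := (ascPochhammer ℝ k).eval α / k.factorial

theorem binomCoeff_nonneg {α : ℝ} (hα : 0 ≤ α) (k : ℕ) : 0 ≤ binomCoeff α k := by
  refine div_nonneg ?_ (by positivity)
  induction k with
  | zero => simp
  | succ k ih => rw [ascPochhammer_succ_eval]; positivity

theorem hasSum_binomCoeff (α : ℝ) {t : ℂ} (ht : ‖t‖ < 1) :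
    HasSum (fun k => (binomCoeff α k : ℂ) * t ^ k) ((1 - t) ^ (-(α : ℂ))) := by
  have h := (Complex.one_div_one_sub_cpow_hasFPowerSeriesOnBall_zero (α : ℂ)).hasSum
    (y := t) (by
      rw [← ENNReal.ofReal_one, Metric.eball_ofReal]; simpa using ht)
  rw [zero_add, one_div, ← Complex.cpow_neg] at h
  refine (congrArg (fun f => HasSum f ((1 - t) ^ (-(α : ℂ)))) (funext fun k => ?_)).mpr h
  have h1 := Ring.factorial_nsmul_multichoose_eq_ascPochhammer (α : ℂ) k
  rw [Polynomial.ascPochhammer_smeval_eq_eval, Ring.multichoose_eq, nsmul_eq_mul] at h1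
  have h2 : ((((ascPochhammer ℝ k).eval α : ℝ)) : ℂ) = (ascPochhammer ℂ k).eval (α : ℂ) := by
    have := Polynomial.eval_map_apply (p := ascPochhammer ℝ k) Complex.ofRealHom α
    rw [ascPochhammer_map] at this
    exact this.symm
  have h3 : (k.factorial : ℂ) ≠ 0 := by exact_mod_cast k.factorial_ne_zero
  rw [FormalMultilinearSeries.ofScalars_apply_eq, smul_eq_mul, binomCoeff]
  push_cast
  rw [h2, ← h1, mul_div_cancel_left₀ _ h3]

theorem summable_binomCoeff {α : ℝ} {r : ℝ} (h0 : 0 ≤ r) (h1 : r < 1) :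
    Summable fun k => binomCoeff α k * r ^ k := by
  have h := (hasSum_binomCoeff α (t := (r : ℂ)) (by simpa [abs_of_nonneg h0] using h1)).summable
  exact_mod_cast h

/-- Follows from Γ(α + m) = α(α + 1)⋯(α + m - 1) Γ(α). It says that the Taylor coefficients of the
kernel are the reciprocals of the normalised radial moments. -/
theorem binomCoeff_mul_beta {α : ℝ} (hα : 1 < α) (m : ℕ) :
    binomCoeff α m * beta (m + 1) (α - 1) = beta 1 (α - 1) := by
  have h0 : ∀ k : ℕ, α + k ≠ 0 := fun k => by positivity
  have hG : ∀ k : ℕ, Real.Gamma (α + k) = (ascPochhammer ℝ k).eval α * Real.Gamma α := by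
    intro k
    induction k with
    | zero => simp
    | succ k ih =>
      rw [Nat.cast_succ, ← add_assoc, Real.Gamma_add_one (h0 k), ih, ascPochhammer_succ_eval]
      ring
  have hm : (ascPochhammer ℝ m).eval α ≠ 0 := (ascPochhammer_pos m α (by linarith)).ne'
  have hΓ : Real.Gamma α ≠ 0 := (Real.Gamma_pos_of_pos (by linarith)).ne'
  have hf : (m.factorial : ℝ) ≠ 0 := by exact_mod_cast m.factorial_ne_zero
  rw [binomCoeff, beta, beta, Real.Gamma_nat_eq_factorial, Real.Gamma_one,
    show (m + 1 + (α - 1) : ℝ) = α + m by ring, show (1 + (α - 1) : ℝ) = α by ring, hG]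
  field_simp

/-- A probability measure on the ball of `ℂⁿ` which represents the norm of the weighted Bergman
space with parameter `α`: it is unitarily invariant and has the right radial moments. -/
structure IsBergmanMeasure {n : ℕ} (α : ℝ) (μ : Measure (EuclideanSpace ℂ (Fin n))) : Prop where
  isProbabilityMeasure : IsProbabilityMeasure μ
  ae_mem_ball : ∀ᵐ z ∂μ, z ∈ Metric.ball (0 : EuclideanSpace ℂ (Fin n)) 1
  measurePreserving : ∀ L : EuclideanSpace ℂ (Fin n) ≃ₗᵢ[ℂ] EuclideanSpace ℂ (Fin n),
    MeasurePreserving L μ μ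
  moment : ∀ u : EuclideanSpace ℂ (Fin n), ‖u‖ = 1 → ∀ m : ℕ,
    binomCoeff α m * ∫ z, ‖(inner ℂ u z : ℂ)‖ ^ (2 * m) ∂μ = 1

theorem exists_isBergmanMeasure (n : ℕ) {α : ℝ} (hα : n < α) :
    ∃ μ : Measure (EuclideanSpace ℂ (Fin n)), IsBergmanMeasure α μ := by
  cases n with
  | zero =>
    -- The ball is a single point, and the moment condition is vacuous because there is no unit
    -- vector.
    refine ⟨Measure.dirac 0, inferInstance, ?_, fun L => ?_, fun u hu => ?_⟩
    · simp
    · refine ⟨L.continuous.measurable, ?_⟩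
      rw [Measure.map_dirac' L.continuous.measurable, map_zero]
    · rw [Subsingleton.elim u 0, norm_zero] at hu
      exact (zero_ne_one hu).elim
  | succ k =>
    -- This is α - n - 1, so β > -1, which makes the weight integrable, amounts to α > n. After
    -- slicing, β + k + 1 = α - 1 is the beta parameter.
    set β : ℝ := α - (k + 1) - 1 with hβ
    have hβ1 : -1 < β := by push_cast at hα; linarith
    have hα1 : 1 < α := by
      have : (0 : ℝ) ≤ k := k.cast_nonneg
      push_cast at hα; linarith
    let e : (Fin (k + 1) → ℂ) ≃L[ℝ] EuclideanSpace ℂ (Fin (k + 1)) :=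
      (PiLp.continuousLinearEquiv 2 ℝ fun _ : Fin (k + 1) => ℂ).symm
    let m : Measure (EuclideanSpace ℂ (Fin (k + 1))) := Measure.map e volume
    have hmH : m.IsAddHaarMeasure := e.isAddHaarMeasure_map volume
    let w : EuclideanSpace ℂ (Fin (k + 1)) → ENNReal := fun z =>
      ENNReal.ofReal (ballWeight β (‖z‖ ^ 2))
    have hw : Measurable w := by fun_prop
    let μ₀ : Measure (EuclideanSpace ℂ (Fin (k + 1))) := m.withDensity w
    have hint : ∀ p : ℕ, ∫⁻ z, ENNReal.ofReal (‖z 0‖ ^ (2 * p)) ∂μ₀ =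
        ENNReal.ofReal (Real.pi * beta (p + 1) (α - 1)) *
          ∫⁻ z : Fin k → ℂ, ENNReal.ofReal (ballWeight β (∑ i, ‖z i‖ ^ 2)) := by
      intro p
      rw [lintegral_withDensity_eq_lintegral_mul _ hw (by fun_prop),
        lintegral_map (by fun_prop) e.continuous.measurable]
      have h := lintegral_pi_ballWeight_succ k p β
      have hk : -1 < β + k := by
        have : (0 : ℝ) ≤ k := k.cast_nonneg
        linarith
      rw [lintegral_complex_pow_mul_ballWeight p hk,
        show β + k + 1 = α - 1 by rw [hβ]; ring] at h
      rw [← h]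
      congr 1 with z
      have hz : ‖e z‖ ^ 2 = ∑ i, ‖z i‖ ^ 2 := EuclideanSpace.norm_sq_eq _
      simp only [Pi.mul_apply, w, hz]
      rw [mul_comm, ← ENNReal.ofReal_mul (by positivity)]
      rfl
    obtain ⟨hI0, hI1⟩ := lintegral_pi_ballWeight_pos_lt_top k hβ1
    set I := ∫⁻ z : Fin k → ℂ, ENNReal.ofReal (ballWeight β (∑ i, ‖z i‖ ^ 2))
    have hbeta : ∀ p : ℕ, 0 < beta (p + 1) (α - 1) := fun p =>
      beta_pos (by positivity) (by linarith)
    have htot : μ₀ univ = ENNReal.ofReal (Real.pi * beta 1 (α - 1)) * I := by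
      have := hint 0
      simpa using this
    have hb1 : 0 < beta 1 (α - 1) := by simpa using hbeta 0
    have hpb : 0 < Real.pi * beta 1 (α - 1) := mul_pos Real.pi_pos hb1
    have ht0 : μ₀ univ ≠ 0 := by
      rw [htot]; exact mul_ne_zero (ENNReal.ofReal_pos.2 hpb).ne' hI0.ne'
    have ht1 : μ₀ univ ≠ ⊤ := by
      rw [htot]; exact ENNReal.mul_ne_top ENNReal.ofReal_ne_top hI1.ne
    have hball : ∀ᵐ z ∂μ₀, z ∈ Metric.ball (0 : EuclideanSpace ℂ (Fin (k + 1))) 1 := by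
      rw [ae_withDensity_iff hw]
      refine ae_of_all _ fun z hz => ?_
      by_contra hn
      refine hz ?_
      have : 1 ≤ ‖z‖ := by simpa using hn
      simp only [w, ballWeight_of_one_le (one_le_pow₀ this), ENNReal.ofReal_zero]
    have hinv : ∀ L : EuclideanSpace ℂ (Fin (k + 1)) ≃ₗᵢ[ℂ] EuclideanSpace ℂ (Fin (k + 1)),
        MeasurePreserving L μ₀ μ₀ := fun L => by
      have hm : MeasurePreserving L m m :=
        LinearIsometryEquiv.measurePreserving_addHaar m
          { L.toLinearEquiv.restrictScalars ℝ with norm_map' := L.norm_map }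
      refine ⟨L.continuous.measurable, Measure.ext fun s hs => ?_⟩
      rw [Measure.map_apply L.continuous.measurable hs,
        withDensity_apply _ (L.continuous.measurable hs), withDensity_apply _ hs,
        ← hm.setLIntegral_comp_preimage hs hw]
      simp [w]
    have hinv' : ∀ L : EuclideanSpace ℂ (Fin (k + 1)) ≃ₗᵢ[ℂ] EuclideanSpace ℂ (Fin (k + 1)),
        MeasurePreserving L ((μ₀ univ)⁻¹ • μ₀) ((μ₀ univ)⁻¹ • μ₀) := fun L =>
      (hinv L).smul_measure _
    refine ⟨(μ₀ univ)⁻¹ • μ₀, ⟨?_⟩, ?_, hinv', fun u hu p => ?_⟩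
    · rw [Measure.smul_apply, smul_eq_mul, ENNReal.inv_mul_cancel ht0 ht1]
    · exact Measure.ae_smul_measure hball _
    · have hcard : Module.finrank ℂ (EuclideanSpace ℂ (Fin (k + 1))) =
          Fintype.card (Fin (k + 1)) := finrank_euclideanSpace
      -- Extend u to an orthonormal basis. Its coordinate map is unitary and turns ⟨·, u⟩ into the
      -- first coordinate, so invariance reduces the moments to those of z₀.
      have horth : Orthonormal ℂ (({0} : Set (Fin (k + 1))).domRestrict fun _ => u) := by
        refine ⟨fun _ => hu, fun i j hij => ?_⟩
        exact (hij (Subtype.ext (i.2.trans j.2.symm))).elim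
      obtain ⟨b, hb⟩ := horth.exists_orthonormalBasis_extension_of_card_eq hcard
      have hu' : ∀ z : EuclideanSpace ℂ (Fin (k + 1)), (inner ℂ u z : ℂ) = b.repr z 0 := fun z => by
        rw [b.repr_apply_apply, hb 0 rfl]
      simp only [hu']
      rw [(hinv' b.repr).integral_comp b.repr.toHomeomorph.measurableEmbedding
        (fun z : EuclideanSpace ℂ (Fin (k + 1)) => ‖z 0‖ ^ (2 * p)), integral_smul_measure,
        integral_eq_lintegral_of_nonneg_ae
        (ae_of_all _ fun z => by positivity) (by fun_prop), hint p, htot,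
        ENNReal.toReal_inv, ENNReal.toReal_mul, ENNReal.toReal_mul,
        ENNReal.toReal_ofReal hpb.le, ENNReal.toReal_ofReal
          (mul_nonneg Real.pi_pos.le (hbeta p).le), smul_eq_mul]
      have hIr : I.toReal ≠ 0 := (ENNReal.toReal_pos hI0.ne' hI1.ne).ne'
      have := binomCoeff_mul_beta hα1 p
      have hπ := Real.pi_ne_zero
      field_simp
      linarith

end BallMeasure

/-! ### The reproducing property, by averaging over rotations. -/

section Reproducing

open MeasureTheory Set

theorem integral_eq_integral_circleAverage {V : Type*} [MeasurableSpace V] {μ : Measure V}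
    [IsFiniteMeasure μ] {R : ℂ → V → V} (hR : Measurable (Function.uncurry R))
    (hmp : ∀ l : ℂ, ‖l‖ = 1 → MeasurePreserving (R l) μ μ) {h : V → ℂ} (hh : Measurable h)
    {C : ℝ} (hC : ∀ z, ‖h z‖ ≤ C) :
    ∫ z, h z ∂μ = ∫ z, Real.circleAverage (fun l => h (R l z)) 0 1 ∂μ := by
  have hmeas : Measurable fun p : V × ℝ => h (R (circleMap 0 1 p.2) p.1) := by
    refine hh.comp (hR.comp (Measurable.prodMk ?_ measurable_fst))
    exact (continuous_circleMap 0 1).measurable.comp measurable_snd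
  have hconst : ∀ θ : ℝ, ∫ z, h (R (circleMap 0 1 θ) z) ∂μ = ∫ z, h z ∂μ := fun θ => by
    have hθ := hmp (circleMap 0 1 θ) (by simp [circleMap])
    have := integral_map (μ := μ) hθ.measurable.aemeasurable (f := h)
      hh.aestronglyMeasurable
    rw [hθ.map_eq] at this
    exact this.symm
  simp only [Real.circleAverage_def]
  rw [integral_smul, ← intervalIntegral_integral_swap
    (f := fun θ z => h (R (circleMap 0 1 θ) z))]
  · simp only [hconst, intervalIntegral.integral_const, sub_zero, ← smul_assoc, smul_eq_mul]
    rw [inv_mul_cancel₀ (by positivity), one_smul]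
  · have hfin : IsFiniteMeasure (volume.restrict (uIoc 0 (2 * Real.pi))) :=
      ⟨by rw [Measure.restrict_apply_univ, uIoc_of_le (by positivity)]; exact measure_Ioc_lt_top⟩
    refine Integrable.of_bound (C := C) ?_ (ae_of_all _ fun p => hC _)
    exact (hmeas.comp measurable_swap).aestronglyMeasurable

/-- On the unit circle l̄ = l⁻¹, so the average is Cauchy's integral for the m-th derivative of l ↦
g(lζ) at 0. -/
theorem circleAverage_mul_conj_pow {g : ℂ → ℂ} (hg : DifferentiableOn ℂ g (Metric.ball 0 1))
    {ζ : ℂ} (hζ : ‖ζ‖ < 1) (m : ℕ) :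
    Real.circleAverage (fun l => g (l * ζ) * (starRingEnd ℂ) (l * ζ) ^ m) 0 1 =
      iteratedDeriv m g 0 / m.factorial * (‖ζ‖ ^ (2 * m) : ℝ) := by
  have hmaps : ∀ l : ℂ, ‖l‖ ≤ 1 → l * ζ ∈ Metric.ball (0 : ℂ) 1 := fun l hl => by
    rw [mem_ball_zero_iff, norm_mul]
    exact mul_lt_one_of_nonneg_of_lt_one_right hl (norm_nonneg _) hζ
  have hd : DiffContOnCl ℂ (fun l => g (ζ * l)) (Metric.ball 0 1) := by
    refine DifferentiableOn.diffContOnCl fun l hl => ?_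
    rw [closure_ball _ one_ne_zero, mem_closedBall_zero_iff] at hl
    have h1 : DifferentiableAt ℂ g (ζ * l) :=
      hg.differentiableAt (Metric.isOpen_ball.mem_nhds (by rw [mul_comm]; exact hmaps l hl))
    exact (h1.comp l (by fun_prop)).differentiableWithinAt
  have h1 := hd.circleIntegral_one_div_sub_center_pow_smul one_pos m
  have h2 : iteratedDeriv m (fun l => g (ζ * l)) 0 = ζ ^ m * iteratedDeriv m g 0 := by
    have h0 : (0 : ℂ) ∈ Metric.ball (0 : ℂ) 1 := Metric.mem_ball_self one_pos
    have h3 := iteratedDerivWithin_comp_const_smul h0 Metric.isOpen_ball.uniqueDiffOn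
      (hg.contDiffOn Metric.isOpen_ball (n := m)) ζ
      (fun l hl => by
        simpa [mul_comm] using hmaps l (mem_ball_zero_iff.1 hl).le)
    rw [mul_zero, iteratedDerivWithin_of_isOpen Metric.isOpen_ball h0,
      iteratedDerivWithin_of_isOpen Metric.isOpen_ball h0] at h3
    exact h3
  rw [Real.circleAverage_eq_circleIntegral one_ne_zero]
  have h4 : (∮ l in C(0, 1), (l - 0)⁻¹ • (g (l * ζ) * (starRingEnd ℂ) (l * ζ) ^ m)) =
      (starRingEnd ℂ) ζ ^ m * ∮ l in C(0, 1), (1 / (l - 0) ^ (m + 1)) • g (ζ * l) := by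
    rw [← smul_eq_mul, ← circleIntegral.integral_smul]
    refine circleIntegral.integral_congr zero_le_one fun l hl => ?_
    have hl1 : ‖l‖ = 1 := by simpa using hl
    have hc : (starRingEnd ℂ) l = l⁻¹ := by
      rw [Complex.inv_def, Complex.normSq_eq_norm_sq]; simp [hl1]
    simp only [sub_zero, map_mul, hc, smul_eq_mul, mul_pow, mul_comm ζ l]
    rw [one_div, pow_succ, mul_inv, inv_pow]
    ring
  rw [h4, h1, h2]
  have h5 : ((‖ζ‖ ^ (2 * m) : ℝ) : ℂ) = ζ ^ m * (starRingEnd ℂ) ζ ^ m := by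
    rw [← mul_pow, Complex.mul_conj, Complex.normSq_eq_norm_sq, pow_mul]
    push_cast
    rfl
  rw [h5]
  have := Complex.two_pi_I_ne_zero
  simp only [smul_eq_mul]
  field_simp

theorem norm_sq_inner_smul_add_smul {V : Type*} [NormedAddCommGroup V] [InnerProductSpace ℂ V]
    {u : V} (hu : ‖u‖ = 1) (l : ℂ) (z : V) :
    ‖(inner ℂ u z : ℂ) • u + l • (z - (inner ℂ u z : ℂ) • u)‖ ^ 2 =
      ‖(inner ℂ u z : ℂ)‖ ^ 2 + ‖l‖ ^ 2 * ‖z - (inner ℂ u z : ℂ) • u‖ ^ 2 := by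
  have h0 : (inner ℂ ((inner ℂ u z : ℂ) • u) (l • (z - (inner ℂ u z : ℂ) • u)) : ℂ) = 0 := by
    rw [inner_smul_left, inner_smul_right, inner_sub_right, inner_smul_right,
      inner_self_eq_norm_sq_to_K, hu]
    simp
  have h := norm_add_sq_eq_norm_sq_add_norm_sq_of_inner_eq_zero _ _ h0
  rw [sq, h, norm_smul, norm_smul, hu]
  ring

/-- The isometry which fixes `u` and multiplies the orthogonal complement of `u` by `l`. -/
noncomputable def orthogonalRotation {V : Type*} [NormedAddCommGroup V] [InnerProductSpace ℂ V]
    [FiniteDimensional ℂ V] {u : V} (hu : ‖u‖ = 1) {l : ℂ} (hl : ‖l‖ = 1) : V ≃ₗᵢ[ℂ] V :=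
  LinearIsometry.toLinearIsometryEquiv
    { toFun := fun z => (inner ℂ u z : ℂ) • u + l • (z - (inner ℂ u z : ℂ) • u)
      map_add' := fun x y => by simp only [inner_add_right]; module
      map_smul' := fun c x => by simp only [inner_smul_right, RingHom.id_apply]; module
      norm_map' := fun z => by
        have h1 := norm_sq_inner_smul_add_smul hu l z
        have h2 := norm_sq_inner_smul_add_smul hu 1 z
        rw [one_smul, add_sub_cancel] at h2
        rw [hl, ← norm_one (α := ℂ), ← h2] at h1
        exact (sq_eq_sq₀ (norm_nonneg _) (norm_nonneg _)).1 h1 } rfl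

theorem norm_inner_smul_add_smul_le {V : Type*} [NormedAddCommGroup V] [InnerProductSpace ℂ V]
    {u : V} (hu : ‖u‖ = 1) {l : ℂ} (hl : ‖l‖ ≤ 1) (z : V) :
    ‖(inner ℂ u z : ℂ) • u + l • (z - (inner ℂ u z : ℂ) • u)‖ ≤ ‖z‖ := by
  have h1 := norm_sq_inner_smul_add_smul hu l z
  have h2 := norm_sq_inner_smul_add_smul hu 1 z
  rw [one_smul, add_sub_cancel, norm_one, one_pow, one_mul] at h2
  have h3 : ‖l‖ ^ 2 ≤ 1 := pow_le_one₀ (norm_nonneg _) hl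
  refine (sq_le_sq₀ (norm_nonneg _) (norm_nonneg _)).1 ?_
  rw [h1, h2]
  nlinarith [sq_nonneg ‖z - (inner ℂ u z : ℂ) • u‖]

theorem inner_inner_smul_add_smul {V : Type*} [NormedAddCommGroup V] [InnerProductSpace ℂ V]
    {u : V} (hu : ‖u‖ = 1) (l : ℂ) (z : V) :
    (inner ℂ u ((inner ℂ u z : ℂ) • u + l • (z - (inner ℂ u z : ℂ) • u)) : ℂ) = inner ℂ u z := by
  rw [inner_add_right, inner_smul_right, inner_smul_right, inner_sub_right, inner_smul_right,
    inner_self_eq_norm_sq_to_K, hu]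
  simp

/-- Multiplication by a unimodular scalar. -/
noncomputable def unitSMul {V : Type*} [NormedAddCommGroup V] [InnerProductSpace ℂ V]
    [FiniteDimensional ℂ V] {l : ℂ} (hl : ‖l‖ = 1) : V ≃ₗᵢ[ℂ] V :=
  LinearIsometry.toLinearIsometryEquiv
    { toFun := fun z => l • z
      map_add' := fun x y => smul_add l x y
      map_smul' := fun c x => smul_comm l c x
      norm_map' := fun z => by
        change ‖l • z‖ = ‖z‖
        rw [norm_smul, hl, one_mul] } rfl

theorem measurable_indicator_ball {V : Type*} [NormedAddCommGroup V] [MeasurableSpace V]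
    [BorelSpace V] {f : V → ℂ} (hf : ContinuousOn f (Metric.ball 0 1)) :
    Measurable ((Metric.ball (0 : V) 1).indicator f) := by
  classical
  rw [← piecewise_eq_indicator]
  exact hf.measurable_piecewise continuousOn_const measurableSet_ball

variable {n : ℕ} {α : ℝ} {μ : Measure (EuclideanSpace ℂ (Fin n))}

/-- Invariance of μ is used twice: rotations about u reduce f to its restriction to the complex line
through u, and scalar rotations then pick out one Taylor coefficient there. The moment of μ cancels
the binomial coefficient. -/
theorem IsBergmanMeasure.integral_mul_conj_inner_pow (hμ : IsBergmanMeasure α μ)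
    {f : EuclideanSpace ℂ (Fin n) → ℂ} (hf : DifferentiableOn ℂ f (Metric.ball 0 1)) {C : ℝ}
    (hC : ∀ z ∈ Metric.ball 0 1, ‖f z‖ ≤ C) {u : EuclideanSpace ℂ (Fin n)} (hu : ‖u‖ = 1)
    (m : ℕ) :
    binomCoeff α m * ∫ z, f z * (starRingEnd ℂ) (inner ℂ u z) ^ m ∂μ =
      iteratedDeriv m (fun ζ : ℂ => f (ζ • u)) 0 / m.factorial := by
  have := hμ.isProbabilityMeasure
  set B : Set (EuclideanSpace ℂ (Fin n)) := Metric.ball 0 1 with hB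
  have hC0 : 0 ≤ C := (norm_nonneg _).trans (hC 0 (Metric.mem_ball_self one_pos))
  have hin : ∀ z ∈ B, ‖(inner ℂ u z : ℂ)‖ < 1 := fun z hz => by
    refine (norm_inner_le_norm u z).trans_lt ?_
    rw [hu, one_mul]
    exact mem_ball_zero_iff.1 hz
  have hgB : ∀ ζ : ℂ, ‖ζ‖ < 1 → ζ • u ∈ B := fun ζ hζ => by
    rw [hB, mem_ball_zero_iff, norm_smul, hu, mul_one]
    exact hζ
  have hg : DifferentiableOn ℂ (fun ζ : ℂ => f (ζ • u)) (Metric.ball 0 1) :=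
    hf.comp (by fun_prop) fun ζ hζ => hgB ζ (mem_ball_zero_iff.1 hζ)
  have hbound : ∀ q : EuclideanSpace ℂ (Fin n) → ℂ, (∀ z ∈ B, ‖q z‖ ≤ C) → ∀ z,
      ‖B.indicator (fun z => q z * (starRingEnd ℂ) (inner ℂ u z) ^ m) z‖ ≤ C := by
    intro q hq z
    by_cases hz : z ∈ B
    · rw [indicator_of_mem hz, norm_mul, norm_pow, RCLike.norm_conj]
      exact (mul_le_mul (hq z hz) (pow_le_one₀ (norm_nonneg _) (hin z hz).le)
        (by positivity) hC0).trans_eq (mul_one C)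
    · rw [indicator_of_notMem hz, norm_zero]
      exact hC0
  -- Nothing is known about f off the ball; cutting off there gives global measurability and
  -- boundedness for Fubini.
  have hind : ∀ q : EuclideanSpace ℂ (Fin n) → ℂ, ∫ z, q z ∂μ = ∫ z, B.indicator q z ∂μ :=
    fun q => integral_congr_ae <| by
      filter_upwards [hμ.ae_mem_ball] with z hz
      rw [indicator_of_mem hz]
  have hmeas : ∀ q : EuclideanSpace ℂ (Fin n) → ℂ, ContinuousOn q B →
      Measurable (B.indicator fun z => q z * (starRingEnd ℂ) (inner ℂ u z) ^ m) := fun q hq =>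
    measurable_indicator_ball (hq.mul (by fun_prop))
  have hproj : ∀ z ∈ B, (inner ℂ u z : ℂ) • u ∈ B := fun z hz => hgB _ (hin z hz)
  -- Rotate the component of z orthogonal to u by l. The integrand is holomorphic in l near the
  -- closed disc, and ⟨z, u⟩ does not change, so the mean value property replaces l by 0.
  have step1 : ∫ z, f z * (starRingEnd ℂ) (inner ℂ u z) ^ m ∂μ =
      ∫ z, f ((inner ℂ u z : ℂ) • u) * (starRingEnd ℂ) (inner ℂ u z) ^ m ∂μ := by
    rw [hind, integral_eq_integral_circleAverage
      (R := fun l z => (inner ℂ u z : ℂ) • u + l • (z - (inner ℂ u z : ℂ) • u))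
      (by unfold Function.uncurry; fun_prop)
      (fun l hl => hμ.measurePreserving (orthogonalRotation hu hl))
      (hmeas f hf.continuousOn) (hbound f hC)]
    refine integral_congr_ae ?_
    filter_upwards [hμ.ae_mem_ball] with z hz
    have hRz : ∀ l : ℂ, ‖l‖ ≤ 1 →
        (inner ℂ u z : ℂ) • u + l • (z - (inner ℂ u z : ℂ) • u) ∈ B := fun l hl => by
      rw [hB, mem_ball_zero_iff]
      exact (norm_inner_smul_add_smul_le hu hl z).trans_lt (mem_ball_zero_iff.1 hz)
    have hd : DiffContOnCl ℂ (fun l : ℂ =>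
        f ((inner ℂ u z : ℂ) • u + l • (z - (inner ℂ u z : ℂ) • u)) *
          (starRingEnd ℂ) (inner ℂ u z) ^ m) (Metric.ball 0 |1|) := by
      refine DifferentiableOn.diffContOnCl fun l hl => ?_
      rw [abs_one, closure_ball _ one_ne_zero, mem_closedBall_zero_iff] at hl
      have h1 := hf.differentiableAt (Metric.isOpen_ball.mem_nhds (hRz l hl))
      exact ((h1.comp l (by fun_prop)).mul_const _).differentiableWithinAt
    have h2 := hd.circleAverage
    rw [zero_smul, add_zero] at h2
    rw [← h2]
    refine Real.circleAverage_congr_sphere fun l hl => ?_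
    have hl1 : ‖l‖ = 1 := by simpa using hl
    simp only [indicator_of_mem (hRz l hl1.le), inner_inner_smul_add_smul hu]
  -- Now rotate all of z by l and apply the Cauchy formula on the disc in the direction u.
  have step2 : ∫ z, f ((inner ℂ u z : ℂ) • u) * (starRingEnd ℂ) (inner ℂ u z) ^ m ∂μ =
      ∫ z, iteratedDeriv m (fun ζ : ℂ => f (ζ • u)) 0 / m.factorial *
        ((‖(inner ℂ u z : ℂ)‖ ^ (2 * m) : ℝ) : ℂ) ∂μ := by
    have hcont : ContinuousOn (fun z => f ((inner ℂ u z : ℂ) • u)) B :=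
      hf.continuousOn.comp (by fun_prop) hproj
    rw [hind, integral_eq_integral_circleAverage (R := fun l z => l • z)
      (by unfold Function.uncurry; fun_prop)
      (fun l hl => hμ.measurePreserving (unitSMul hl))
      (hmeas _ hcont) (hbound _ fun z hz => hC _ (hproj z hz))]
    refine integral_congr_ae ?_
    filter_upwards [hμ.ae_mem_ball] with z hz
    rw [← circleAverage_mul_conj_pow hg (hin z hz) m]
    refine Real.circleAverage_congr_sphere fun l hl => ?_
    have hl1 : ‖l‖ = 1 := by simpa using hl
    have hlz : l • z ∈ B := by
      rw [hB, mem_ball_zero_iff, norm_smul, hl1, one_mul]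
      exact mem_ball_zero_iff.1 hz
    simp only [indicator_of_mem hlz, inner_smul_right]
  rw [step1, step2, integral_const_mul, integral_complex_ofReal]
  have h := hμ.moment u hu m
  rw [mul_left_comm, ← Complex.ofReal_mul, h, Complex.ofReal_one, mul_one]

/-- With x = r u, expand the kernel in powers of r times the conjugate of ⟨z, u⟩ and integrate
termwise. The result is the Taylor series of ζ ↦ f(ζu) at ζ = r. -/
theorem IsBergmanMeasure.integral_mul_kernel (hμ : IsBergmanMeasure α μ) (hα : 0 ≤ α)
    {f : EuclideanSpace ℂ (Fin n) → ℂ} (hf : DifferentiableOn ℂ f (Metric.ball 0 1)) {C : ℝ}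
    (hC : ∀ z ∈ Metric.ball 0 1, ‖f z‖ ≤ C) {x : EuclideanSpace ℂ (Fin n)}
    (hx : x ∈ Metric.ball 0 1) :
    ∫ z, f z * (1 - inner ℂ z x) ^ (-(α : ℂ)) ∂μ = f x := by
  have := hμ.isProbabilityMeasure
  have hC0 : 0 ≤ C := (norm_nonneg _).trans (hC 0 (Metric.mem_ball_self one_pos))
  -- For x = 0 any unit vector serves; in dimension 0 there is none, and that case is checked
  -- directly.
  obtain ⟨u, r, hr0, hr1, hxu, hu⟩ : ∃ (u : EuclideanSpace ℂ (Fin n)) (r : ℝ),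
      0 ≤ r ∧ r < 1 ∧ x = (r : ℂ) • u ∧ (‖u‖ = 1 ∨ Subsingleton (EuclideanSpace ℂ (Fin n))) := by
    rcases subsingleton_or_nontrivial (EuclideanSpace ℂ (Fin n)) with h | h
    · exact ⟨x, 0, le_rfl, one_pos, Subsingleton.elim _ _, Or.inr h⟩
    · rcases eq_or_ne x 0 with rfl | hx0
      · obtain ⟨v, hv⟩ := exists_norm_eq (EuclideanSpace ℂ (Fin n)) zero_le_one
        exact ⟨v, 0, le_rfl, one_pos, by simp, Or.inl hv⟩
      · have h0 : ‖x‖ ≠ 0 := norm_ne_zero_iff.2 hx0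
        refine ⟨((‖x‖⁻¹ : ℝ) : ℂ) • x, ‖x‖, norm_nonneg _, mem_ball_zero_iff.1 hx, ?_, Or.inl ?_⟩
        · rw [smul_smul, ← Complex.ofReal_mul, mul_inv_cancel₀ h0, Complex.ofReal_one, one_smul]
        · rw [norm_smul, Complex.norm_real, norm_inv, norm_norm, inv_mul_cancel₀ h0]
  rcases hu with hu | hu
  swap
  · have h0 : ∀ z, z = x := fun z => Subsingleton.elim _ _
    have hx0 : x = 0 := Subsingleton.elim _ _
    have h1 : ∀ z, f z * (1 - inner ℂ z x) ^ (-(α : ℂ)) = f x := fun z => by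
      rw [h0 z, hx0, inner_zero_left, sub_zero, Complex.one_cpow, mul_one]
    simp [h1]
  have hin : ∀ z ∈ Metric.ball (0 : EuclideanSpace ℂ (Fin n)) 1, ‖(inner ℂ u z : ℂ)‖ ≤ 1 :=
    fun z hz => by
      refine (norm_inner_le_norm u z).trans ?_
      rw [hu, one_mul]
      exact (mem_ball_zero_iff.1 hz).le
  have hzx : ∀ z, (inner ℂ z x : ℂ) = r * (starRingEnd ℂ) (inner ℂ u z) := fun z => by
    rw [hxu, inner_smul_right, inner_conj_symm]
  have hsum : HasSum (fun m => ∫ z, (binomCoeff α m : ℂ) * (r : ℂ) ^ m *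
      (f z * (starRingEnd ℂ) (inner ℂ u z) ^ m) ∂μ)
      (∫ z, f z * (1 - inner ℂ z x) ^ (-(α : ℂ)) ∂μ) := by
    have hs := summable_binomCoeff (α := α) hr0 hr1
    refine hasSum_integral_of_dominated_convergence (fun m _ => C * (binomCoeff α m * r ^ m))
      (fun m => ?_) (fun m => ?_) (ae_of_all _ fun _ => hs.mul_left C) (integrable_const _) ?_
    · have h1 := measurable_indicator_ball hf.continuousOn
      have h2 : Measurable fun z => (binomCoeff α m : ℂ) * (r : ℂ) ^ m *
          ((Metric.ball 0 1).indicator f z * (starRingEnd ℂ) (inner ℂ u z) ^ m) := by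
        refine Measurable.const_mul (h1.mul ?_) _
        exact Continuous.measurable (by fun_prop)
      refine h2.aestronglyMeasurable.congr ?_
      filter_upwards [hμ.ae_mem_ball] with z hz
      rw [indicator_of_mem hz]
    · filter_upwards [hμ.ae_mem_ball] with z hz
      have hb := binomCoeff_nonneg hα m
      rw [norm_mul, norm_mul, norm_mul, norm_pow, norm_pow, RCLike.norm_conj, Complex.norm_real,
        Complex.norm_real, Real.norm_of_nonneg hb, Real.norm_of_nonneg hr0, mul_comm]
      refine mul_le_mul_of_nonneg_right ?_ (by positivity)
      exact (mul_le_mul (hC z hz) (pow_le_one₀ (norm_nonneg _) (hin z hz))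
        (by positivity) hC0).trans_eq (mul_one C)
    · filter_upwards [hμ.ae_mem_ball] with z hz
      have h1 : ‖(inner ℂ z x : ℂ)‖ < 1 := by
        rw [hzx, norm_mul, RCLike.norm_conj, Complex.norm_real, Real.norm_of_nonneg hr0]
        exact mul_lt_one_of_nonneg_of_lt_one_left hr0 hr1 (hin z hz)
      have h2 := (hasSum_binomCoeff α h1).mul_left (f z)
      refine h2.congr_fun fun m => ?_
      rw [hzx, mul_pow]
      ring
  have hg : DifferentiableOn ℂ (fun ζ : ℂ => f (ζ • u)) (Metric.ball 0 1) :=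
    hf.comp (by fun_prop) fun ζ hζ => by
      rw [mem_ball_zero_iff, norm_smul, hu, mul_one]
      exact mem_ball_zero_iff.1 hζ
  have htaylor := Complex.hasSum_taylorSeries_on_ball hg (z := (r : ℂ))
    (by simpa [abs_of_nonneg hr0] using hr1)
  rw [hxu] at hsum ⊢
  refine hsum.unique (htaylor.congr_fun fun m => ?_)
  rw [integral_const_mul, mul_right_comm, hμ.integral_mul_conj_inner_pow hf hC hu m]
  simp only [sub_zero, smul_eq_mul]
  ring

end Reproducing

/-! ### A criterion for a function to belong to a reproducing kernel Hilbert space. -/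

section RieszCriterion

variable {X E : Type*} [NormedAddCommGroup E] [InnerProductSpace ℂ E] [CompleteSpace E]
variable (H : Type*) [NormedAddCommGroup H] [InnerProductSpace ℂ H] [CompleteSpace H]
  [RKHS ℂ H X E]

/-- Finite linear combinations of kernel functions. -/
noncomputable def kerLin : (X →₀ E) →ₗ[ℂ] H :=
  Finsupp.lsum ℂ fun x => (RKHS.kerFun H x : E →ₗ[ℂ] H)

theorem kerLin_single (x : X) (η : E) : kerLin H (Finsupp.single x η) = RKHS.kerFun H x η := by
  simp [kerLin]

theorem denseRange_kerLin : DenseRange (kerLin H (X := X) (E := E)) := by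
  have h : (Submodule.span ℂ {RKHS.kerFun H x v | (x : X) (v : E)}) ≤
      LinearMap.range (kerLin H (X := X) (E := E)) := by
    refine Submodule.span_le.2 ?_
    rintro _ ⟨x, v, rfl⟩
    exact ⟨Finsupp.single x v, kerLin_single H x v⟩
  have h2 := Submodule.topologicalClosure_mono h
  rw [RKHS.kerFun_dense, top_le_iff] at h2
  intro F
  have h3 : F ∈ (LinearMap.range (kerLin H (X := X) (E := E))).topologicalClosure := by
    rw [h2]; exact Submodule.mem_top
  exact h3

variable {H}

theorem inner_kerLin (v : X →₀ E) (F : H) :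
    inner ℂ (kerLin H v) F = v.sum fun x η => inner ℂ η (F x) := by
  simp [kerLin, Finsupp.sum]

/-- The bound says that pairing with g is a well-defined bounded functional on the dense span of the
kernel functions. Its Riesz representative is G. -/
theorem exists_rkhs_of_forall_norm_sum_inner_le {g : X → E} {C : ℝ} (hC : 0 ≤ C)
    (h : ∀ v : X →₀ E, ‖v.sum fun x η => inner ℂ η (g x)‖ ≤ C * ‖kerLin H v‖) :
    ∃ G : H, (∀ x, G x = g x) ∧ ‖G‖ ≤ C := by
  -- The conjugate of the sum in the hypothesis, which makes it linear in v.
  let l : (X →₀ E) →ₗ[ℂ] ℂ := Finsupp.lsum ℂ fun x => (innerSL ℂ (g x) : E →ₗ[ℂ] ℂ)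
  have hl : ∀ v, l v = (starRingEnd ℂ) (v.sum fun x η => inner ℂ η (g x)) := fun v => by
    simp [l, Finsupp.sum, inner_conj_symm]
  have hb : ∀ v, ‖l v‖ ≤ C * ‖kerLin H v‖ := fun v => by
    rw [hl, RCLike.norm_conj]; exact h v
  have hd := denseRange_kerLin H (X := X) (E := E)
  set L := l.extendOfNorm (kerLin H)
  have hG : ∀ F, inner ℂ ((InnerProductSpace.toDual ℂ H).symm L) F = L F := fun F =>
    InnerProductSpace.toDual_symm_apply
  refine ⟨(InnerProductSpace.toDual ℂ H).symm L, fun x => ?_, ?_⟩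
  · refine ext_inner_right ℂ fun η => ?_
    rw [← RKHS.inner_kerFun, hG, ← kerLin_single,
      LinearMap.extendOfNorm_eq hd ⟨C, hb⟩]
    simp [l]
  · have hle := LinearMap.norm_extendOfNorm_apply_le hd C hb
      ((InnerProductSpace.toDual ℂ H).symm L)
    rw [← hG, inner_self_eq_norm_sq_to_K, norm_pow, RCLike.norm_ofReal, abs_norm, sq] at hle
    rcases (norm_nonneg ((InnerProductSpace.toDual ℂ H).symm L)).eq_or_lt with h1 | h1
    · rw [← h1]; exact hC
    · exact le_of_mul_le_mul_right hle h1

end RieszCriterion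

/-! ### Bounded holomorphic functions act as multipliers. -/

section BergmanMultiplier

open MeasureTheory

variable {n : ℕ} {α : ℝ} {E : Type*} [NormedAddCommGroup E] [InnerProductSpace ℂ E]

/-- The function `z ↦ ∑ (1 - ⟨z, y⟩) ^ (-α) • v y` on `ℂⁿ`. -/
noncomputable def kerSum (α : ℝ) (v : UnitBall n →₀ E) (z : EuclideanSpace ℂ (Fin n)) : E :=
  v.sum fun y η => (1 - inner ℂ y.1 z : ℂ) ^ (-(α : ℂ)) • η

theorem kerSum_single (y : UnitBall n) (η : E) (z : EuclideanSpace ℂ (Fin n)) :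
    kerSum α (Finsupp.single y η) z = (1 - inner ℂ y.1 z : ℂ) ^ (-(α : ℂ)) • η := by
  rw [kerSum]
  exact Finsupp.sum_single_index (smul_zero _)

theorem norm_inner_lt_one {y z : EuclideanSpace ℂ (Fin n)} (hy : y ∈ Metric.ball 0 1)
    (hz : z ∈ Metric.ball 0 1) : ‖(inner ℂ y z : ℂ)‖ < 1 := by
  rw [mem_ball_zero_iff] at hy hz
  exact (norm_inner_le_norm y z).trans_lt
    (mul_lt_one_of_nonneg_of_lt_one_left (norm_nonneg _) hy hz.le)

theorem conj_kernel {y z : EuclideanSpace ℂ (Fin n)} (hy : y ∈ Metric.ball 0 1)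
    (hz : z ∈ Metric.ball 0 1) :
    (starRingEnd ℂ) ((1 - inner ℂ y z : ℂ) ^ (-(α : ℂ))) = (1 - inner ℂ z y) ^ (-(α : ℂ)) := by
  have h1 := (hasSum_binomCoeff α (norm_inner_lt_one hy hz)).star
  refine h1.unique ?_
  convert hasSum_binomCoeff α (norm_inner_lt_one hz hy) using 2 with k
  simp

theorem differentiableOn_kerSum (v : UnitBall n →₀ E) :
    DifferentiableOn ℂ (kerSum α v) (Metric.ball 0 1) := by
  unfold kerSum Finsupp.sum
  refine DifferentiableOn.fun_sum fun y _ => DifferentiableOn.smul_const ?_ _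
  intro z hz
  have h1 : DifferentiableAt ℂ (fun z => (1 - inner ℂ y.1 z : ℂ)) z := by
    have := (innerSL ℂ y.1).differentiableAt (x := z)
    exact (differentiableAt_const _).sub this
  refine (h1.cpow_const (Or.inl ?_)).differentiableWithinAt
  have h2 := (Complex.re_le_norm (inner ℂ y.1 z)).trans_lt (norm_inner_lt_one y.2 hz)
  rw [Complex.sub_re, Complex.one_re]
  linarith

theorem exists_norm_kerSum_le (hα : 0 ≤ α) (v : UnitBall n →₀ E) :
    ∃ C : ℝ, ∀ z ∈ Metric.ball 0 1, ‖kerSum α v z‖ ≤ C := by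
  refine ⟨v.sum fun y η => (∑' k, binomCoeff α k * ‖y.1‖ ^ k) * ‖η‖, fun z hz => ?_⟩
  refine (norm_sum_le _ _).trans (Finset.sum_le_sum fun y _ => ?_)
  rw [norm_smul]
  refine mul_le_mul_of_nonneg_right ?_ (norm_nonneg _)
  have hs := hasSum_binomCoeff α (norm_inner_lt_one y.2 hz)
  rw [← hs.tsum_eq]
  refine tsum_of_norm_bounded
    (summable_binomCoeff (norm_nonneg _) (mem_ball_zero_iff.1 y.2)).hasSum fun k => ?_
  have hb := binomCoeff_nonneg hα k
  rw [norm_mul, norm_pow, Complex.norm_real, Real.norm_of_nonneg hb]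
  refine mul_le_mul_of_nonneg_left (pow_le_pow_left₀ (norm_nonneg _) ?_ _) hb
  refine (norm_inner_le_norm _ _).trans (mul_le_of_le_one_right (norm_nonneg _) ?_)
  exact (mem_ball_zero_iff.1 hz).le

variable {μ : Measure (EuclideanSpace ℂ (Fin n))}

theorem IsBergmanMeasure.memLp {F : Type*} [NormedAddCommGroup F] (hμ : IsBergmanMeasure α μ)
    {h : EuclideanSpace ℂ (Fin n) → F} (hh : ContinuousOn h (Metric.ball 0 1)) {C : ℝ}
    (hC : ∀ z ∈ Metric.ball 0 1, ‖h z‖ ≤ C) (p : ENNReal) : MemLp h p μ := by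
  have := hμ.isProbabilityMeasure
  have h1 : μ.restrict (Metric.ball 0 1) = μ := Measure.restrict_eq_self_of_ae_mem hμ.ae_mem_ball
  have h2 := hh.aestronglyMeasurable (μ := μ) measurableSet_ball
  rw [h1] at h2
  refine MemLp.of_bound h2 C ?_
  filter_upwards [hμ.ae_mem_ball] with z hz using hC z hz

/-- The scalar reproducing property applied to each ⟨h(·), η⟩. It turns the functional of the Riesz
criterion into an L²(μ) pairing. -/
theorem IsBergmanMeasure.sum_inner_eq_integral (hμ : IsBergmanMeasure α μ) (hα : 0 ≤ α)
    {h : EuclideanSpace ℂ (Fin n) → E} (hh : DifferentiableOn ℂ h (Metric.ball 0 1)) {C : ℝ}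
    (hC : ∀ z ∈ Metric.ball 0 1, ‖h z‖ ≤ C) (v : UnitBall n →₀ E) :
    (v.sum fun x η => inner ℂ η (h x)) = ∫ z, inner ℂ (kerSum α v z) (h z) ∂μ := by
  have hsc : ∀ η : E, DifferentiableOn ℂ (fun z => (inner ℂ η (h z) : ℂ)) (Metric.ball 0 1) :=
    fun η => (innerSL ℂ η).differentiable.comp_differentiableOn hh
  have hscb : ∀ η : E, ∀ z ∈ Metric.ball 0 1, ‖(inner ℂ η (h z) : ℂ)‖ ≤ ‖η‖ * C :=
    fun η z hz => (norm_inner_le_norm _ _).trans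
      (mul_le_mul_of_nonneg_left (hC z hz) (norm_nonneg _))
  have hterm : ∀ (x : UnitBall n) (η : E), (inner ℂ η (h x) : ℂ) =
      ∫ z, inner ℂ (kerSum α (Finsupp.single x η) z) (h z) ∂μ := fun x η => by
    rw [← hμ.integral_mul_kernel hα (hsc η) (hscb η) x.2]
    refine integral_congr_ae ?_
    filter_upwards [hμ.ae_mem_ball] with z hz
    rw [kerSum_single, inner_smul_left, conj_kernel x.2 hz, mul_comm]
  have hint : ∀ (x : UnitBall n) (η : E),
      Integrable (fun z => (inner ℂ (kerSum α (Finsupp.single x η) z) (h z) : ℂ)) μ :=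
    fun x η => by
      obtain ⟨D, hD⟩ := exists_norm_kerSum_le hα (Finsupp.single x η)
      have hc := (differentiableOn_kerSum (α := α) (Finsupp.single x η)).continuousOn.inner
        (𝕜 := ℂ) hh.continuousOn
      refine memLp_one_iff_integrable.1 (hμ.memLp hc (C := D * C) (fun z hz => ?_) 1)
      refine (norm_inner_le_norm _ _).trans ?_
      exact mul_le_mul (hD z hz) (hC z hz) (norm_nonneg _) ((norm_nonneg _).trans (hD z hz))
  simp only [Finsupp.sum, hterm]
  rw [← integral_finsetSum _ fun x _ => hint x _]
  refine integral_congr_ae (Filter.Eventually.of_forall fun z => ?_)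
  simp only [kerSum_single]
  rw [kerSum, Finsupp.sum, sum_inner]

variable [CompleteSpace E] [Fact ((n : ℝ) < α)]

theorem kerFun_bergman_apply (x y : UnitBall n) (η : E) :
    RKHS.kerFun (HilbertTensor (WeightedBergman n α) E) y η x =
      (1 - inner ℂ y.1 x.1 : ℂ) ^ (-(α : ℂ)) • η := by
  rw [RKHS.kerFun_apply, kernel_hilbertTensor, RKHS.OfKernel.kernel_ofKernel]
  simp [bergmanKernel]

theorem kerLin_bergman_apply (v : UnitBall n →₀ E) (x : UnitBall n) :
    kerLin (HilbertTensor (WeightedBergman n α) E) v x = kerSum α v x := by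
  induction v using Finsupp.induction_linear with
  | zero => simp [kerSum]
  | add v w hv hw =>
    rw [map_add, RKHS.coe_add, Pi.add_apply, hv, hw, kerSum, kerSum, kerSum,
      Finsupp.sum_add_index'] <;> simp
  | single y η =>
    rw [kerLin_single, kerFun_bergman_apply, kerSum_single]

/-- Pair a kernel sum with itself; kernel sums are bounded and holomorphic on the ball. -/
theorem IsBergmanMeasure.norm_kerLin_sq (hμ : IsBergmanMeasure α μ) (hα : 0 ≤ α)
    (v : UnitBall n →₀ E) :
    ‖kerLin (HilbertTensor (WeightedBergman n α) E) v‖ ^ 2 = ∫ z, ‖kerSum α v z‖ ^ 2 ∂μ := by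
  obtain ⟨D, hD⟩ := exists_norm_kerSum_le hα v
  have h1 := hμ.sum_inner_eq_integral hα (differentiableOn_kerSum v) hD v
  have h2 := inner_kerLin v (kerLin (HilbertTensor (WeightedBergman n α) E) v)
  simp only [kerLin_bergman_apply] at h2
  rw [h1, inner_self_eq_norm_sq_to_K] at h2
  have h3 : ∀ z, (inner ℂ (kerSum α v z) (kerSum α v z) : ℂ) =
      ((‖kerSum α v z‖ ^ 2 : ℝ) : ℂ) := fun z => by
    rw [inner_self_eq_norm_sq_to_K]; push_cast; rfl
  simp only [h3] at h2
  rw [integral_complex_ofReal] at h2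
  refine Complex.ofReal_injective (Eq.trans ?_ h2)
  push_cast
  rfl

/-- Cauchy–Schwarz in L²(μ) is the bound required by the Riesz criterion. The inequality of norms
suffices for what follows. -/
theorem IsBergmanMeasure.exists_eq_of_bounded (hμ : IsBergmanMeasure α μ) (hα : 0 ≤ α)
    {h : EuclideanSpace ℂ (Fin n) → E} (hh : DifferentiableOn ℂ h (Metric.ball 0 1)) {C : ℝ}
    (hC : ∀ z ∈ Metric.ball 0 1, ‖h z‖ ≤ C) :
    ∃ G : HilbertTensor (WeightedBergman n α) E,
      (∀ x : UnitBall n, G x = h x) ∧ ‖G‖ ^ 2 ≤ ∫ z, ‖h z‖ ^ 2 ∂μ := by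
  have hI : 0 ≤ ∫ z, ‖h z‖ ^ 2 ∂μ := integral_nonneg fun z => by positivity
  obtain ⟨G, hG, hn⟩ := exists_rkhs_of_forall_norm_sum_inner_le
    (H := HilbertTensor (WeightedBergman n α) E) (g := fun x : UnitBall n => h x)
    (C := √(∫ z, ‖h z‖ ^ 2 ∂μ)) (Real.sqrt_nonneg _) fun v => by
      obtain ⟨D, hD⟩ := exists_norm_kerSum_le hα v
      have hLh := (hμ.memLp hh.continuousOn hC 2).norm
      have hLv := (hμ.memLp (differentiableOn_kerSum (α := α) v).continuousOn hD 2).norm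
      rw [hμ.sum_inner_eq_integral hα hh hC v]
      refine (norm_integral_le_integral_norm _).trans ?_
      have h2 : ENNReal.ofReal 2 = 2 := by simp
      have hCS := integral_mul_le_Lp_mul_Lq_of_nonneg (μ := μ)
        (Real.HolderConjugate.two_two)
        (Filter.Eventually.of_forall fun z => norm_nonneg (h z))
        (Filter.Eventually.of_forall fun z => norm_nonneg (kerSum α v z))
        (by rw [h2]; exact hLh) (by rw [h2]; exact hLv)
      simp only [Real.rpow_two, ← Real.sqrt_eq_rpow] at hCS
      rw [← hμ.norm_kerLin_sq hα v, Real.sqrt_sq (norm_nonneg _)] at hCS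
      refine le_trans (integral_mono_of_nonneg
        (Filter.Eventually.of_forall fun z => norm_nonneg _) ?_
        (Filter.Eventually.of_forall fun z => ?_)) hCS
      · exact hLh.integrable_mul hLv
      · exact (norm_inner_le_norm _ _).trans_eq (mul_comm _ _)
  refine ⟨G, hG, ?_⟩
  calc ‖G‖ ^ 2 ≤ (√(∫ z, ‖h z‖ ^ 2 ∂μ)) ^ 2 := pow_le_pow_left₀ (norm_nonneg _) hn 2
    _ = _ := Real.sq_sqrt hI

theorem exists_mul_eq {φ : EuclideanSpace ℂ (Fin n) → E →L[ℂ] E}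
    (hφ : DifferentiableOn ℂ φ (Metric.ball 0 1)) {C : ℝ} (hC0 : 0 ≤ C)
    (hC : ∀ z ∈ Metric.ball 0 1, ‖φ z‖ ≤ C) (F : HilbertTensor (WeightedBergman n α) E) :
    ∃ G : HilbertTensor (WeightedBergman n α) E,
      (∀ x : UnitBall n, G x = φ x (F x)) ∧ ‖G‖ ≤ C * ‖F‖ := by
  have hα' : (n : ℝ) < α := Fact.out
  have hα : 0 ≤ α := (Nat.cast_nonneg n).trans hα'.le
  obtain ⟨μ, hμ⟩ := exists_isBergmanMeasure n hα'
  refine exists_rkhs_of_forall_norm_sum_inner_le (mul_nonneg hC0 (norm_nonneg _)) fun v => ?_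
  -- For general F the function φF need not be bounded. For fixed v, however, the Riesz bound is a
  -- closed condition on F, so kernel sums, which are bounded, are enough.
  refine (denseRange_kerLin (HilbertTensor (WeightedBergman n α) E)).induction_on
    (p := fun F => ‖v.sum fun x η => inner ℂ η (φ x (F x))‖ ≤ C * ‖F‖ *
      ‖kerLin (HilbertTensor (WeightedBergman n α) E) v‖) F ?_ fun w => ?_
  · refine isClosed_le ?_ (by fun_prop)
    refine continuous_norm.comp (continuous_finsetSum _ fun x _ => ?_)
    exact continuous_const.inner ((φ x).continuous.comp (RKHS.continuous_eval x))
  · obtain ⟨D, hD⟩ := exists_norm_kerSum_le hα w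
    have hb : ∀ z ∈ Metric.ball 0 1, ‖φ z (kerSum α w z)‖ ≤ C * ‖kerSum α w z‖ := fun z hz =>
      (φ z).le_of_opNorm_le (hC z hz) _
    have hb' : ∀ z ∈ Metric.ball 0 1, ‖φ z (kerSum α w z)‖ ≤ C * D := fun z hz =>
      (hb z hz).trans (mul_le_mul_of_nonneg_left (hD z hz) hC0)
    obtain ⟨G, hG, hn⟩ := hμ.exists_eq_of_bounded hα
      (hφ.clm_apply (differentiableOn_kerSum (α := α) w)) hb'
    have hle : ‖G‖ ≤ C * ‖kerLin (HilbertTensor (WeightedBergman n α) E) w‖ := by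
      refine (sq_le_sq₀ (norm_nonneg _) (by positivity)).1 (hn.trans ?_)
      rw [mul_pow, hμ.norm_kerLin_sq hα w, ← integral_const_mul]
      refine integral_mono_of_nonneg (Filter.Eventually.of_forall fun z => by positivity) ?_ ?_
      · exact ((hμ.memLp (differentiableOn_kerSum (α := α) w).continuousOn hD 2).norm
          |>.integrable_sq).const_mul _
      · filter_upwards [hμ.ae_mem_ball] with z hz
        rw [← mul_pow]
        exact pow_le_pow_left₀ (norm_nonneg _) (hb z hz) 2
    have h1 := inner_kerLin v G
    simp only [hG, ← kerLin_bergman_apply] at h1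
    rw [← h1, mul_comm]
    exact (norm_inner_le_norm _ _).trans (mul_le_mul_of_nonneg_left hle (norm_nonneg _))

theorem isMultiplier_of_bounded {φ : EuclideanSpace ℂ (Fin n) → E →L[ℂ] E}
    (hφ : IsBoundedHolomorphic φ) :
    IsMultiplier (HilbertTensor (WeightedBergman n α) E) (fun z : UnitBall n => φ z) := by
  obtain ⟨hd, C, hC⟩ := hφ
  intro F
  have hC0 : 0 ≤ C := (norm_nonneg _).trans (hC 0 (Metric.mem_ball_self one_pos))
  obtain ⟨G, hG, -⟩ := exists_mul_eq hd hC0 hC F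
  exact ⟨G, hG⟩

end BergmanMultiplier

/-! ### The operators I ⊗ V, acting pointwise by V. -/

section IdTensor

variable {E H : Type*} [NormedAddCommGroup E] [InnerProductSpace ℂ E] [NormedAddCommGroup H]
  [InnerProductSpace ℂ H]

theorem idTensor_coe_tmul (V : E →L[ℂ] E) (f : H) (η : E) :
    idTensor H V ((f ⊗ₜ[ℂ] η : H ⊗[ℂ] E) : HilbertTensor H E) =
      ((f ⊗ₜ[ℂ] V η : H ⊗[ℂ] E) : HilbertTensor H E) := by
  rw [idTensor, ContinuousLinearMap.completion_apply_coe, ContinuousLinearMap.lTensor_tmul]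

theorem norm_idTensor {V : E →L[ℂ] E} (hV : Isometry V) (F : HilbertTensor H E) :
    ‖idTensor H V F‖ = ‖F‖ := by
  induction F using UniformSpace.Completion.induction_on with
  | hp => exact isClosed_eq (by fun_prop) (by fun_prop)
  | ih F =>
    let W : E →ₗᵢ[ℂ] E := ⟨V, (AddMonoidHomClass.isometry_iff_norm _).1 hV⟩
    have h : V.lTensor H F = W.lTensor H F := by
      rw [ContinuousLinearMap.lTensor_apply]; rfl
    rw [idTensor, ContinuousLinearMap.completion_apply_coe, UniformSpace.Completion.norm_coe,
      UniformSpace.Completion.norm_coe, h, LinearIsometry.norm_map]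

variable {X : Type*} [CompleteSpace E] [CompleteSpace H] [RKHS ℂ H X ℂ]

theorem idTensor_apply (V : E →L[ℂ] E) (F : HilbertTensor H E) (x : X) :
    idTensor H V F x = V (F x) := by
  induction F using UniformSpace.Completion.induction_on with
  | hp =>
    exact isClosed_eq ((RKHS.continuous_eval x).comp (idTensor H V).continuous)
      (V.continuous.comp (RKHS.continuous_eval x))
  | ih F =>
    induction F using TensorProduct.induction_on with
    | zero =>
      rw [UniformSpace.Completion.coe_zero, map_zero, RKHS.coe_zero, Pi.zero_apply, map_zero]
    | tmul f η => rw [idTensor_coe_tmul, hilbertTensor_coe_tmul, hilbertTensor_coe_tmul, map_smul]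
    | add F G hF hG =>
      rw [UniformSpace.Completion.coe_add, map_add, RKHS.coe_add, RKHS.coe_add, Pi.add_apply,
        Pi.add_apply, hF, hG, map_add]

end IdTensor

/-! ### Isometric multipliers have constant symbol. -/

section BergmanIsometry

open MeasureTheory

variable {n : ℕ} {α : ℝ} {E : Type*} [NormedAddCommGroup E] [InnerProductSpace ℂ E]
  [CompleteSpace E] [Fact ((n : ℝ) < α)]

/-- The origin of the unit ball. -/
def ballZero (n : ℕ) : UnitBall n := ⟨0, Metric.mem_ball_self one_pos⟩

theorem kerFun_ballZero_apply (η : E) (x : UnitBall n) :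
    RKHS.kerFun (HilbertTensor (WeightedBergman n α) E) (ballZero n) η x = η := by
  rw [kerFun_bergman_apply, ballZero, inner_zero_left, sub_zero, Complex.one_cpow, one_smul]

theorem norm_kerFun_ballZero (η : E) :
    ‖RKHS.kerFun (HilbertTensor (WeightedBergman n α) E) (ballZero n) η‖ = ‖η‖ := by
  have h := RKHS.kerFun_inner (ballZero n) η
    (RKHS.kerFun (HilbertTensor (WeightedBergman n α) E) (ballZero n) η)
  rw [kerFun_ballZero_apply, inner_self_eq_norm_sq_to_K, inner_self_eq_norm_sq_to_K] at h
  have h' : ‖RKHS.kerFun (HilbertTensor (WeightedBergman n α) E) (ballZero n) η‖ ^ 2 =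
      ‖η‖ ^ 2 := by exact_mod_cast h
  exact (sq_eq_sq₀ (norm_nonneg _) (norm_nonneg _)).1 h'

theorem kernel_diag (α : ℝ) (x : UnitBall n) :
    (1 - inner ℂ x.1 x.1 : ℂ) ^ (-(α : ℂ)) = (((1 - ‖x.1‖ ^ 2) ^ (-α) : ℝ) : ℂ) ∧
      0 < (1 - ‖x.1‖ ^ 2) ^ (-α) := by
  have h : 0 < 1 - ‖x.1‖ ^ 2 := by
    have := mem_ball_zero_iff.1 x.2
    nlinarith [norm_nonneg x.1]
  refine ⟨?_, Real.rpow_pos_of_pos h _⟩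
  rw [Complex.ofReal_cpow h.le, inner_self_eq_norm_sq_to_K]
  push_cast
  rfl

theorem norm_kerFun_bergman_sq (x : UnitBall n) (η : E) :
    ‖RKHS.kerFun (HilbertTensor (WeightedBergman n α) E) x η‖ ^ 2 =
      (1 - ‖x.1‖ ^ 2) ^ (-α) * ‖η‖ ^ 2 := by
  have h := RKHS.kerFun_inner x η (RKHS.kerFun (HilbertTensor (WeightedBergman n α) E) x η)
  rw [kerFun_bergman_apply, (kernel_diag α x).1, inner_smul_right,
    inner_self_eq_norm_sq_to_K, inner_self_eq_norm_sq_to_K] at h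
  refine Complex.ofReal_injective ?_
  push_cast
  exact h

/-- A pointwise bound for the symbol of a bounded multiplication operator. -/
theorem norm_symbol_le {ψ : UnitBall n → E →L[ℂ] E}
    {T : HilbertTensor (WeightedBergman n α) E → HilbertTensor (WeightedBergman n α) E}
    (hT : ∀ F x, T F x = ψ x (F x)) (hn : ∀ F, ‖T F‖ ≤ ‖F‖) (x : UnitBall n) : ‖ψ x‖ ≤ 1 := by
  obtain ⟨hk, hpos⟩ := kernel_diag α x
  have key : ∀ ξ η : E, ‖(inner ℂ ξ (ψ x η) : ℂ)‖ ≤ ‖ξ‖ * ‖η‖ := fun ξ η => by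
    set Kξ := RKHS.kerFun (HilbertTensor (WeightedBergman n α) E) x ξ
    set Kη := RKHS.kerFun (HilbertTensor (WeightedBergman n α) E) x η with hKη
    -- Both kernel functions sit at the same point x, so the diagonal value of the kernel appears on
    -- both sides of the estimate and cancels.
    have h1 : inner ℂ Kξ (T Kη) = ((1 - ‖x.1‖ ^ 2) ^ (-α) : ℝ) * inner ℂ ξ (ψ x η) := by
      rw [RKHS.kerFun_inner, hT, hKη, kerFun_bergman_apply, map_smul, inner_smul_right, hk]
    have h2 : ‖inner ℂ Kξ (T Kη)‖ ≤ ‖Kξ‖ * ‖Kη‖ :=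
      (norm_inner_le_norm _ _).trans (mul_le_mul_of_nonneg_left (hn _) (norm_nonneg _))
    rw [h1, norm_mul, Complex.norm_real, Real.norm_of_nonneg hpos.le] at h2
    have h3 : ‖Kξ‖ * ‖Kη‖ = (1 - ‖x.1‖ ^ 2) ^ (-α) * (‖ξ‖ * ‖η‖) := by
      refine (sq_eq_sq₀ (by positivity) (by positivity)).1 ?_
      rw [mul_pow, norm_kerFun_bergman_sq, norm_kerFun_bergman_sq]
      ring
    rw [h3] at h2
    exact le_of_mul_le_mul_left h2 hpos
  refine (ψ x).opNorm_le_bound zero_le_one fun η => ?_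
  have h := key (ψ x η) η
  rw [inner_self_eq_norm_sq_to_K, norm_pow, RCLike.norm_ofReal, abs_norm, sq] at h
  rw [one_mul]
  rcases (norm_nonneg (ψ x η)).eq_or_lt with h0 | h0
  · rw [← h0]; exact norm_nonneg _
  · exact le_of_mul_le_mul_left h h0

theorem eq_of_isometry_mulOp {φ : EuclideanSpace ℂ (Fin n) → E →L[ℂ] E}
    (hφ : DifferentiableOn ℂ φ (Metric.ball 0 1))
    (hM : IsMultiplier (HilbertTensor (WeightedBergman n α) E) (fun z : UnitBall n => φ z))
    (hI : Isometry (mulOp _ hM)) :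
    Isometry (φ 0) ∧ ∀ z ∈ Metric.ball 0 1, φ z = φ 0 := by
  have hα' : (n : ℝ) < α := Fact.out
  have hα : 0 ≤ α := (Nat.cast_nonneg n).trans hα'.le
  obtain ⟨μ, hμ⟩ := exists_isBergmanMeasure n hα'
  have := hμ.isProbabilityMeasure
  have hnorm : ∀ F, ‖mulOp _ hM F‖ = ‖F‖ := (AddMonoidHomClass.isometry_iff_norm _).1 hI
  have h1 : ∀ z ∈ Metric.ball 0 1, ‖φ z‖ ≤ 1 := fun z hz =>
    norm_symbol_le (ψ := fun z : UnitBall n => φ z) (mulOp_apply _ hM)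
      (fun F => (hnorm F).le) ⟨z, hz⟩
  have key : ∀ η, ‖φ 0 η‖ = ‖η‖ ∧ ∀ z ∈ Metric.ball 0 1, φ z η = φ 0 η := fun η => by
    have hle : ∀ z ∈ Metric.ball 0 1, ‖φ z η‖ ≤ ‖η‖ := fun z hz => by
      simpa using (φ z).le_of_opNorm_le (h1 z hz) η
    have hd : DifferentiableOn ℂ (fun z => φ z η) (Metric.ball 0 1) :=
      hφ.clm_apply (differentiableOn_const _)
    obtain ⟨G, hG, hGn⟩ := hμ.exists_eq_of_bounded hα hd hle
    have hGeq : G = mulOp _ hM (RKHS.kerFun _ (ballZero n) η) := RKHS.ext fun x => by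
      rw [hG, mulOp_apply, kerFun_ballZero_apply]
    rw [hGeq, hnorm, norm_kerFun_ballZero] at hGn
    -- Otherwise ‖φ(z)η‖ < ‖η‖ μ-almost everywhere, and integrating against the probability measure
    -- μ contradicts ‖η‖² ≤ ∫ ‖φ(z)η‖² dμ.
    obtain ⟨z₀, hz₀, hz₀n⟩ : ∃ z ∈ Metric.ball 0 1, ‖η‖ ≤ ‖φ z η‖ := by
      by_contra hcon
      push Not at hcon
      have hi : Integrable (fun z => ‖φ z η‖ ^ 2) μ :=
        (hμ.memLp hd.continuousOn hle 2).norm.integrable_sq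
      have hlt : ∀ᵐ z ∂μ, 0 < ‖η‖ ^ 2 - ‖φ z η‖ ^ 2 := by
        filter_upwards [hμ.ae_mem_ball] with z hz
        exact sub_pos.2 (pow_lt_pow_left₀ (hcon z hz) (norm_nonneg _) two_ne_zero)
      have hint : ∫ z, (‖η‖ ^ 2 - ‖φ z η‖ ^ 2) ∂μ = ‖η‖ ^ 2 - ∫ z, ‖φ z η‖ ^ 2 ∂μ := by
        rw [integral_sub (integrable_const _) hi]
        simp
      have h0 : ∫ z, (‖η‖ ^ 2 - ‖φ z η‖ ^ 2) ∂μ = 0 :=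
        le_antisymm (by rw [hint]; linarith)
          (integral_nonneg_of_ae (hlt.mono fun z hz => hz.le))
      have h2 := (integral_eq_zero_iff_of_nonneg_ae (hlt.mono fun z hz => hz.le)
        ((integrable_const _).sub hi)).1 h0
      obtain ⟨z, hz, hz'⟩ := (hlt.and h2).exists
      exact hz.ne' hz'
    have hmax : IsMaxOn (norm ∘ fun z => φ z η) (Metric.ball 0 1) z₀ := fun z hz =>
      (hle z hz).trans hz₀n
    -- Supplies the strict convexity of E, by which constant norm forces a constant vector in the
    -- maximum principle.
    let : InnerProductSpace ℝ E := InnerProductSpace.rclikeToReal ℂ E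
    have heq := Complex.eqOn_of_isPreconnected_of_isMaxOn_norm
      (convex_ball (0 : EuclideanSpace ℂ (Fin n)) 1).isPreconnected Metric.isOpen_ball hd hz₀ hmax
    have h00 := heq (Metric.mem_ball_self one_pos)
    simp only [Function.const] at h00
    refine ⟨?_, fun z hz => ?_⟩
    · rw [h00]
      exact le_antisymm (hle z₀ hz₀) hz₀n
    · rw [h00]
      exact heq hz
  exact ⟨AddMonoidHomClass.isometry_of_norm _ fun η => (key η).1,
    fun z hz => ContinuousLinearMap.ext fun η => (key η).2 z hz⟩

end BergmanIsometry

/-! ### The range of I ⊗ V. -/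

section IdTensorRange

variable {E H : Type*} [NormedAddCommGroup E] [InnerProductSpace ℂ E] [NormedAddCommGroup H]
  [InnerProductSpace ℂ H]

/-- `I_H ⊗ V` as an isometry, for an isometry `V`. -/
noncomputable def idTensorIsometry {V : E →L[ℂ] E} (hV : Isometry V) :
    HilbertTensor H E →ₗᵢ[ℂ] HilbertTensor H E :=
  ⟨idTensor H V, norm_idTensor hV⟩

/-- Elementary tensors match on both sides; the range of an isometry of a complete space is closed,
so it contains the closure of their span. -/
theorem range_idTensorIsometry {V : E →L[ℂ] E} (hV : Isometry V) :
    LinearMap.range (idTensorIsometry (H := H) hV).toLinearMap =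
      tensorSubspace H (LinearMap.range (V : E →ₗ[ℂ] E)) := by
  refine le_antisymm ?_ (Submodule.topologicalClosure_minimal _ (Submodule.span_le.2 ?_) ?_)
  · rintro _ ⟨F, rfl⟩
    change idTensor H V F ∈ tensorSubspace H (LinearMap.range (V : E →ₗ[ℂ] E))
    induction F using UniformSpace.Completion.induction_on with
    | hp =>
      exact (Submodule.isClosed_topologicalClosure _).preimage (idTensor H V).continuous
    | ih F =>
      induction F using TensorProduct.induction_on with
      | zero =>
        rw [UniformSpace.Completion.coe_zero, map_zero]
        exact Submodule.zero_mem _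
      | tmul f η =>
        rw [idTensor_coe_tmul]
        exact Submodule.le_topologicalClosure _ (Submodule.subset_span ⟨f, V η, ⟨η, rfl⟩, rfl⟩)
      | add F G hF hG =>
        rw [UniformSpace.Completion.coe_add, map_add]
        exact Submodule.add_mem _ hF hG
  · rintro _ ⟨f, _, ⟨η, rfl⟩, rfl⟩
    exact ⟨((f ⊗ₜ[ℂ] η : H ⊗[ℂ] E) : HilbertTensor H E), idTensor_coe_tmul V f η⟩
  · have h := (idTensorIsometry (H := H) hV).isometry.isClosedEmbedding.isClosed_range
    exact h

end IdTensorRange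

/-! ### The series (1 - b)^(-α) for operators b of norm less than 1. -/

section OperatorSeries

theorem inner_adjoint_pow {H : Type*} [NormedAddCommGroup H] [InnerProductSpace ℂ H]
    [CompleteSpace H] (A : H →L[ℂ] H) (k : ℕ) (x y : H) :
    inner ℂ x ((A.adjoint ^ k) y) = inner ℂ ((A ^ k) x) y := by
  rw [← ContinuousLinearMap.star_eq_adjoint, ← star_pow, ContinuousLinearMap.star_eq_adjoint,
    ContinuousLinearMap.adjoint_inner_right]

/-- The linear map of adjoints of a contractive conjugate-linear family of operators. -/
noncomputable def adjointOfConjLinear {V H : Type*} [NormedAddCommGroup V] [NormedSpace ℂ V]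
    [NormedAddCommGroup H] [InnerProductSpace ℂ H] [CompleteSpace H] (A : V → H →L[ℂ] H)
    (hadd : ∀ z w, A (z + w) = A z + A w)
    (hsmul : ∀ (c : ℂ) z, A (c • z) = (starRingEnd ℂ) c • A z) (hle : ∀ z, ‖A z‖ ≤ ‖z‖) :
    V →L[ℂ] (H →L[ℂ] H) :=
  LinearMap.mkContinuous
    { toFun := fun z => (A z).adjoint
      map_add' := fun z w => by rw [hadd, map_add]
      map_smul' := fun c z => by
        rw [hsmul, ← ContinuousLinearMap.star_eq_adjoint, star_smul, RCLike.star_def,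
          Complex.conj_conj, ContinuousLinearMap.star_eq_adjoint, RingHom.id_apply] } 1 fun z => by
      rw [one_mul]
      exact (LinearIsometryEquiv.norm_map (ContinuousLinearMap.adjoint (𝕜 := ℂ) (E := H) (F := H))
        (A z)).trans_le (hle z)

theorem norm_adjointOfConjLinear_le {V H : Type*} [NormedAddCommGroup V] [NormedSpace ℂ V]
    [NormedAddCommGroup H] [InnerProductSpace ℂ H] [CompleteSpace H] {A : V → H →L[ℂ] H}
    (hadd : ∀ z w, A (z + w) = A z + A w)
    (hsmul : ∀ (c : ℂ) z, A (c • z) = (starRingEnd ℂ) c • A z) (hle : ∀ z, ‖A z‖ ≤ ‖z‖) (z : V) :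
    ‖adjointOfConjLinear A hadd hsmul hle z‖ ≤ ‖z‖ :=
  (LinearIsometryEquiv.norm_map (ContinuousLinearMap.adjoint (𝕜 := ℂ) (E := H) (F := H))
    (A z)).trans_le (hle z)

theorem one_le_radius_binomCoeff {α : ℝ} (A : Type*) [NormedRing A] [NormedAlgebra ℂ A] :
    1 ≤ (FormalMultilinearSeries.ofScalars A fun k => (binomCoeff α k : ℂ)).radius := by
  refine ENNReal.le_of_forall_nnreal_lt fun r hr => ?_
  have hr1 : (r : ℝ) < 1 := by exact_mod_cast hr
  refine FormalMultilinearSeries.le_radius_of_summable _ ?_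
  have hs := (summable_binomCoeff (α := α) r.2 hr1).norm
  refine Summable.of_norm_bounded_eventually_nat hs ?_
  -- The term k = 0 is left out because the norm of the unit of A is not controlled.
  filter_upwards [Filter.eventually_gt_atTop 0] with k hk
  rw [norm_mul, norm_mul, norm_norm]
  refine mul_le_mul_of_nonneg_right ?_ (norm_nonneg _)
  refine (FormalMultilinearSeries.ofScalars_norm_le _ _ k hk).trans_eq ?_
  rw [Complex.norm_real]

theorem differentiableOn_tsum_binomCoeff {α : ℝ} (A : Type*) [NormedRing A] [NormedAlgebra ℂ A]
    [CompleteSpace A] :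
    DifferentiableOn ℂ (fun b : A => ∑' k, (binomCoeff α k : ℂ) • b ^ k) (Metric.ball 0 1) ∧
      ∀ b : A, ‖b‖ < 1 → Summable fun k => (binomCoeff α k : ℂ) • b ^ k := by
  set p := FormalMultilinearSeries.ofScalars A fun k => (binomCoeff α k : ℂ) with hp
  have hr : 1 ≤ p.radius := one_le_radius_binomCoeff A
  have h := (p.hasFPowerSeriesOnBall (one_pos.trans_le hr)).mono one_pos hr
  have hball : Metric.eball (0 : A) 1 = Metric.ball 0 1 := by
    rw [← ENNReal.ofReal_one, Metric.eball_ofReal]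
  refine ⟨?_, fun b hb => ?_⟩
  · have hd := h.differentiableOn
    rw [hball] at hd
    refine hd.congr fun b _ => ?_
    simp [FormalMultilinearSeries.sum, hp, FormalMultilinearSeries.ofScalars_apply_eq]
  · rw [← mem_ball_zero_iff, ← hball] at hb
    have := (h.hasSum hb).summable
    simpa [hp, FormalMultilinearSeries.ofScalars_apply_eq] using this

theorem summable_binomCoeff_smul_pow {α : ℝ} {H : Type*} [NormedAddCommGroup H]
    [NormedSpace ℂ H] [CompleteSpace H] {b : H →L[ℂ] H} (hb : ‖b‖ < 1) :
    Summable fun k => (binomCoeff α k : ℂ) • b ^ k :=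
  (differentiableOn_tsum_binomCoeff (α := α) (H →L[ℂ] H)).2 b hb

/-- An analytic function of an operator depending linearly on z, compressed by P and Q. This is the
source of operator-norm holomorphy of the symbol. -/
theorem differentiableOn_clm_comp_tsum_binomCoeff {α : ℝ} {V H E : Type*} [NormedAddCommGroup V]
    [NormedSpace ℂ V] [NormedAddCommGroup H] [NormedSpace ℂ H] [CompleteSpace H]
    [NormedAddCommGroup E] [NormedSpace ℂ E] (L : V →L[ℂ] H →L[ℂ] H) (hL : ∀ z, ‖L z‖ ≤ ‖z‖)
    (P : H →L[ℂ] E) (Q : E →L[ℂ] H) :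
    DifferentiableOn ℂ (fun z => P ∘L (∑' k, (binomCoeff α k : ℂ) • L z ^ k) ∘L Q)
      (Metric.ball 0 1) := by
  have hd := (differentiableOn_tsum_binomCoeff (α := α) (H →L[ℂ] H)).1.comp
    (s := Metric.ball 0 1) L.differentiable.differentiableOn fun z hz => by
      rw [mem_ball_zero_iff] at hz
      exact mem_ball_zero_iff.2 ((hL z).trans_lt hz)
  exact (differentiableOn_const P).clm_comp (hd.clm_comp (differentiableOn_const Q))

end OperatorSeries

/-! ### Isometries commuting with the coordinates are multiplications. -/

section Commutant

variable {n : ℕ} {α : ℝ} {E : Type*} [NormedAddCommGroup E] [InnerProductSpace ℂ E]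
  [CompleteSpace E] [Fact ((n : ℝ) < α)]

theorem isHilbertModule_bergman : IsHilbertModule (HilbertTensor (WeightedBergman n α) E)
    (Ω := Metric.ball (0 : EuclideanSpace ℂ (Fin n)) 1) := fun j =>
  isMultiplier_of_bounded (φ := fun z => z j • ContinuousLinearMap.id ℂ E) <| by
    refine ⟨DifferentiableOn.smul_const (by fun_prop) _, 1, fun z hz => ?_⟩
    refine (norm_smul_le _ _).trans ?_
    have h1 : ‖z j‖ ≤ 1 := (PiLp.norm_apply_le z j).trans (mem_ball_zero_iff.1 hz).le
    exact mul_le_one₀ h1 (norm_nonneg _) ContinuousLinearMap.norm_id_le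

variable (α E) in
theorem exists_innerMul (w : EuclideanSpace ℂ (Fin n)) :
    ∃ A : HilbertTensor (WeightedBergman n α) E →L[ℂ] HilbertTensor (WeightedBergman n α) E,
      (∀ F (x : UnitBall n), A F x = (inner ℂ w x.1 : ℂ) • F x) ∧ ‖A‖ ≤ ‖w‖ := by
  have hd : DifferentiableOn ℂ (fun z => (inner ℂ w z : ℂ) • ContinuousLinearMap.id ℂ E)
      (Metric.ball 0 1) :=
    (innerSL ℂ w).differentiable.differentiableOn.smul_const _
  have hb : ∀ z ∈ Metric.ball (0 : EuclideanSpace ℂ (Fin n)) 1,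
      ‖(inner ℂ w z : ℂ) • ContinuousLinearMap.id ℂ E‖ ≤ ‖w‖ := fun z hz => by
    refine (norm_smul_le _ _).trans ?_
    have h1 : ‖(inner ℂ w z : ℂ)‖ ≤ ‖w‖ := (norm_inner_le_norm _ _).trans
      (mul_le_of_le_one_right (norm_nonneg _) (mem_ball_zero_iff.1 hz).le)
    exact (mul_le_mul h1 ContinuousLinearMap.norm_id_le (norm_nonneg _)
      (norm_nonneg _)).trans_eq (mul_one _)
  have hex := exists_mul_eq (α := α) hd (norm_nonneg w) hb
  have hM : IsMultiplier (HilbertTensor (WeightedBergman n α) E)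
      (fun z : UnitBall n => (inner ℂ w z.1 : ℂ) • ContinuousLinearMap.id ℂ E) := fun F =>
    let ⟨G, hG, _⟩ := hex F
    ⟨G, hG⟩
  refine ⟨(mulOp _ hM).mkContinuous ‖w‖ fun F => ?_, fun F x => mulOp_apply _ hM F x,
    LinearMap.mkContinuous_norm_le _ (norm_nonneg _) _⟩
  obtain ⟨G, hG, hn⟩ := hex F
  have : mulOp _ hM F = G := RKHS.ext fun x => by rw [hG, mulOp_apply]
  rw [this]
  exact hn

variable (α E) in
/-- Multiplication by the linear function `z ↦ ⟨z, w⟩`. -/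
noncomputable def innerMul (w : EuclideanSpace ℂ (Fin n)) :
    HilbertTensor (WeightedBergman n α) E →L[ℂ] HilbertTensor (WeightedBergman n α) E :=
  (exists_innerMul α E w).choose

theorem innerMul_apply (w : EuclideanSpace ℂ (Fin n))
    (F : HilbertTensor (WeightedBergman n α) E) (x : UnitBall n) :
    innerMul α E w F x = (inner ℂ w x.1 : ℂ) • F x :=
  (exists_innerMul α E w).choose_spec.1 F x

theorem norm_innerMul_le (w : EuclideanSpace ℂ (Fin n)) : ‖innerMul α E w‖ ≤ ‖w‖ :=
  (exists_innerMul α E w).choose_spec.2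

theorem innerMul_pow_apply (w : EuclideanSpace ℂ (Fin n)) (k : ℕ)
    (F : HilbertTensor (WeightedBergman n α) E) (x : UnitBall n) :
    (innerMul α E w ^ k) F x = (inner ℂ w x.1 : ℂ) ^ k • F x := by
  induction k with
  | zero => simp
  | succ k ih =>
    rw [pow_succ', mul_apply_eq_comp, innerMul_apply, ih, smul_smul, pow_succ']

/-- The kernel function at 0 is the constant η, and the binomial series in multiplication by ⟨·, w⟩
carries it to the kernel function at w. The bound by ‖w‖ < 1 gives convergence in norm, and
evaluation identifies the sum. -/
theorem hasSum_innerMul_pow (hα : 0 ≤ α) {w : EuclideanSpace ℂ (Fin n)}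
    (hw : w ∈ Metric.ball 0 1) (η : E) :
    HasSum (fun k => (binomCoeff α k : ℂ) • (innerMul α E w ^ k)
        (RKHS.kerFun (HilbertTensor (WeightedBergman n α) E) (ballZero n) η))
      (RKHS.kerFun (HilbertTensor (WeightedBergman n α) E) (⟨w, hw⟩ : UnitBall n) η) := by
  have hw1 := mem_ball_zero_iff.1 hw
  set c := RKHS.kerFun (HilbertTensor (WeightedBergman n α) E) (ballZero n) η with hc
  have hs : Summable fun k => (binomCoeff α k : ℂ) • (innerMul α E w ^ k) c := by
    refine Summable.of_norm_bounded
      ((summable_binomCoeff (α := α) (norm_nonneg w) hw1).mul_right ‖c‖) fun k => ?_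
    have hb := binomCoeff_nonneg hα k
    rw [norm_smul, Complex.norm_real, Real.norm_of_nonneg hb, mul_assoc]
    refine mul_le_mul_of_nonneg_left ?_ hb
    have hp : ∀ k : ℕ, ‖(innerMul α E w ^ k) c‖ ≤ ‖w‖ ^ k * ‖c‖ := fun k => by
      induction k with
      | zero => simp
      | succ k ih =>
        rw [pow_succ', mul_apply_eq_comp, pow_succ', mul_assoc]
        exact ((innerMul α E w).le_of_opNorm_le (norm_innerMul_le w) _).trans
          (mul_le_mul_of_nonneg_left ih (norm_nonneg _))
    exact hp k
  have heq : ∑' k, (binomCoeff α k : ℂ) • (innerMul α E w ^ k) c =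
      RKHS.kerFun (HilbertTensor (WeightedBergman n α) E) (⟨w, hw⟩ : UnitBall n) η := by
    refine RKHS.ext fun x => ?_
    let ev : HilbertTensor (WeightedBergman n α) E →L[ℂ] E := tensorEval _ E x
    have h1 := hs.hasSum.mapL ev
    refine h1.unique ?_
    rw [kerFun_bergman_apply]
    refine ((hasSum_binomCoeff α (norm_inner_lt_one hw x.2)).smul_const η).congr_fun fun k => ?_
    change ((binomCoeff α k : ℂ) • (innerMul α E w ^ k) c : HilbertTensor _ E) x = _
    rw [RKHS.coe_smul, Pi.smul_apply, innerMul_pow_apply, hc, kerFun_ballZero_apply, smul_smul]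
  rw [← heq]
  exact hs.hasSum

theorem innerMul_add (z w : EuclideanSpace ℂ (Fin n)) :
    innerMul α E (z + w) = innerMul α E z + innerMul α E w := by
  refine ContinuousLinearMap.ext fun F => RKHS.ext fun x => ?_
  rw [add_apply, RKHS.coe_add, Pi.add_apply, innerMul_apply, innerMul_apply, innerMul_apply,
    inner_add_left, add_smul]

theorem innerMul_smul (c : ℂ) (z : EuclideanSpace ℂ (Fin n)) :
    innerMul α E (c • z) = (starRingEnd ℂ) c • innerMul α E z := by
  refine ContinuousLinearMap.ext fun F => RKHS.ext fun x => ?_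
  rw [smul_apply, RKHS.coe_smul, Pi.smul_apply, innerMul_apply, innerMul_apply, inner_smul_left,
    mul_smul]

variable (n α E) in
/-- The linear map which sends `z` to the adjoint of multiplication by `⟨·, z⟩`. -/
noncomputable def adjointInnerMul : EuclideanSpace ℂ (Fin n) →L[ℂ]
    (HilbertTensor (WeightedBergman n α) E →L[ℂ] HilbertTensor (WeightedBergman n α) E) :=
  adjointOfConjLinear (innerMul α E) innerMul_add innerMul_smul norm_innerMul_le

theorem norm_adjointInnerMul_le (z : EuclideanSpace ℂ (Fin n)) :
    ‖adjointInnerMul n α E z‖ ≤ ‖z‖ :=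
  norm_adjointOfConjLinear_le innerMul_add innerMul_smul norm_innerMul_le z

theorem adjointInnerMul_apply (z : EuclideanSpace ℂ (Fin n)) :
    adjointInnerMul n α E z = (innerMul α E z).adjoint := rfl

/-- Evaluation at `z` is evaluation at `0` of `(1 - B z) ^ (-α)`, with `B z` the adjoint of
multiplication by `⟨·, z⟩`. -/
theorem apply_eq_tsum_apply_zero (hα : 0 ≤ α) (F : HilbertTensor (WeightedBergman n α) E)
    (z : UnitBall n) :
    F z = (∑' k, (binomCoeff α k : ℂ) • adjointInnerMul n α E z.1 ^ k) F (ballZero n) := by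
  refine ext_inner_left ℂ fun η => ?_
  have hB : ‖adjointInnerMul n α E z.1‖ < 1 :=
    (norm_adjointInnerMul_le _).trans_lt (mem_ball_zero_iff.1 z.2)
  have hs := (summable_binomCoeff_smul_pow (α := α) hB).hasSum
  have h1 := ((ContinuousLinearMap.apply ℂ _ F).hasSum hs).mapL
    (innerSL ℂ (RKHS.kerFun (HilbertTensor (WeightedBergman n α) E) (ballZero n) η))
  -- Pairing F with the expansion of the kernel function at z and conjugating moves the powers onto
  -- F as adjoints.
  have h2 := (hasSum_innerMul_pow hα z.2 η).mapL ((innerSL ℂ F))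
  have h3 := h2.star
  rw [← RKHS.kerFun_inner, ← RKHS.kerFun_inner]
  refine HasSum.unique (f := fun k => _) ?_ h1
  refine Eq.mp (congrArg₂ HasSum (funext fun k => ?_) ?_) h3
  · simp only [innerSL_apply_apply, ContinuousLinearMap.apply_apply, smul_apply,
      inner_smul_right, star_mul', RCLike.star_def, Complex.conj_ofReal, inner_conj_symm]
    congr 1
    rw [adjointInnerMul_apply, inner_adjoint_pow]
  · simp only [innerSL_apply_apply, RCLike.star_def, inner_conj_symm]

/-- The symbol must be φ(z)η = T(η)(z), η being the constant function. Commutation gives the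
multiplication formula on kernel functions through their power series, and density extends it to all
F. -/
theorem exists_symbol_of_commute (hα : 0 ≤ α)
    {T : HilbertTensor (WeightedBergman n α) E →L[ℂ] HilbertTensor (WeightedBergman n α) E}
    (hn : ∀ F, ‖T F‖ = ‖F‖) (hT : ∀ w F, T (innerMul α E w F) = innerMul α E w (T F)) :
    ∃ φ : EuclideanSpace ℂ (Fin n) → E →L[ℂ] E, IsBoundedHolomorphic φ ∧
      ∀ F (z : UnitBall n), T F z = φ z (F z) := by
  let K : E →L[ℂ] HilbertTensor (WeightedBergman n α) E := RKHS.kerFun _ (ballZero n)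
  let ev : HilbertTensor (WeightedBergman n α) E →L[ℂ] E := tensorEval _ E (ballZero n)
  -- Evaluation at z is written as a series in the operators B z, so that differentiability in
  -- operator norm can be read off.
  let φ : EuclideanSpace ℂ (Fin n) → E →L[ℂ] E := fun z =>
    ev ∘L (∑' k, (binomCoeff α k : ℂ) • adjointInnerMul n α E z ^ k) ∘L T ∘L K
  have hφ : ∀ (z : UnitBall n) η, φ z η = T (K η) z := fun z η =>
    (apply_eq_tsum_apply_zero hα (T (K η)) z).symm
  have hpow : ∀ w (k : ℕ) F, T ((innerMul α E w ^ k) F) = (innerMul α E w ^ k) (T F) :=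
    fun w k F => by
      induction k with
      | zero => simp
      | succ k ih =>
        rw [pow_succ', mul_apply_eq_comp, mul_apply_eq_comp, hT, ih]
  have hker : ∀ (w : UnitBall n) η (z : UnitBall n),
      T (RKHS.kerFun _ w η) z = φ z (RKHS.kerFun (HilbertTensor (WeightedBergman n α) E) w η z) :=
    fun w η z => by
      let evz : HilbertTensor (WeightedBergman n α) E →L[ℂ] E := tensorEval _ E z
      have h1 := ((hasSum_innerMul_pow hα w.2 η).mapL T).mapL evz
      refine h1.unique ?_
      rw [kerFun_bergman_apply, map_smul, hφ]
      refine ((hasSum_binomCoeff α (norm_inner_lt_one w.2 z.2)).smul_const _).congr_fun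
        fun k => ?_
      rw [map_smul, hpow]
      change ((binomCoeff α k : ℂ) • (innerMul α E w.1 ^ k) (T (K η)) : HilbertTensor _ E) z = _
      rw [RKHS.coe_smul, Pi.smul_apply, innerMul_pow_apply, smul_smul]
  have hall : ∀ F (z : UnitBall n), T F z = φ z (F z) := fun F z => by
    refine (denseRange_kerLin (HilbertTensor (WeightedBergman n α) E)).induction_on
      (p := fun F => T F z = φ z (F z)) F ?_ fun v => ?_
    · exact isClosed_eq ((RKHS.continuous_eval z).comp T.continuous)
        ((φ z).continuous.comp (RKHS.continuous_eval z))
    · induction v using Finsupp.induction_linear with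
      | zero => rw [map_zero, map_zero, RKHS.coe_zero, Pi.zero_apply, map_zero]
      | add v w hv hw =>
        rw [map_add, map_add, RKHS.coe_add, RKHS.coe_add, Pi.add_apply, Pi.add_apply, hv, hw,
          map_add]
      | single w η => rw [kerLin_single, hker]
  refine ⟨φ, ⟨?_, 1, fun z hz => ?_⟩, hall⟩
  · exact differentiableOn_clm_comp_tsum_binomCoeff _ norm_adjointInnerMul_le ev (T ∘L K)
  · exact norm_symbol_le (ψ := fun z : UnitBall n => φ z) hall (fun F => (hn F).le) ⟨z, hz⟩

end Commutant

/-! ### The two equivalences. -/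

section MainResult

variable {n : ℕ} {α : ℝ} {E : Type*} [NormedAddCommGroup E] [InnerProductSpace ℂ E]
  [CompleteSpace E] [Fact ((n : ℝ) < α)]

theorem isometry_mulOp_iff {φ : EuclideanSpace ℂ (Fin n) → E →L[ℂ] E}
    (hφ : IsBoundedHolomorphic φ)
    (hM : IsMultiplier (HilbertTensor (WeightedBergman n α) E) (fun z : UnitBall n => φ z)) :
    Isometry (mulOp _ hM) ↔
      ∃ V : E →L[ℂ] E, Isometry V ∧ mulOp _ hM = idTensor (WeightedBergman n α) V := by
  constructor
  · intro hI
    obtain ⟨h0, hc⟩ := eq_of_isometry_mulOp hφ.1 hM hI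
    refine ⟨φ 0, h0, LinearMap.ext fun F => RKHS.ext fun x => ?_⟩
    rw [mulOp_apply, hc x.1 x.2]
    exact (idTensor_apply (φ 0) F x).symm
  · rintro ⟨V, hV, h⟩
    refine AddMonoidHomClass.isometry_of_norm _ fun F => ?_
    rw [h]
    exact norm_idTensor hV F

theorem innerMul_eq_sum (w : EuclideanSpace ℂ (Fin n))
    (F : HilbertTensor (WeightedBergman n α) E) :
    innerMul α E w F = ∑ j, (starRingEnd ℂ) (w j) • mulOp _ (isHilbertModule_bergman j) F := by
  refine RKHS.ext fun x => ?_
  let ev : HilbertTensor (WeightedBergman n α) E →L[ℂ] E := tensorEval _ E x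
  have h : ∀ G : HilbertTensor (WeightedBergman n α) E, ev G = G x := fun G => rfl
  rw [innerMul_apply, ← h (∑ j, _), map_sum, PiLp.inner_apply, Finset.sum_smul]
  refine Finset.sum_congr rfl fun j _ => ?_
  rw [map_smul, h, mulOp_apply, coordFun]
  simp [smul_smul, mul_comm]

theorem exists_isometry_of_unitarilyEquivalent
    {S : Submodule ℂ (HilbertTensor (WeightedBergman n α) E)}
    (h : UnitarilyEquivalent S (HilbertTensor (WeightedBergman n α) E)) :
    ∃ V : E →L[ℂ] E, ∃ hV : Isometry V,
      S = LinearMap.range (idTensorIsometry (H := WeightedBergman n α) hV).toLinearMap := by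
  have hα : 0 ≤ α := (Nat.cast_nonneg n).trans (Fact.out : (n : ℝ) < α).le
  obtain ⟨h₁, h₂, U, hU⟩ := h
  -- The inverse of U followed by the inclusion: an isometric module map of the full space into
  -- itself with range S.
  let W : HilbertTensor (WeightedBergman n α) E →ₗᵢ[ℂ] HilbertTensor (WeightedBergman n α) E :=
    S.subtypeₗᵢ.comp U.symm.toLinearIsometry
  have hW : ∀ F, W F = (U.symm F : HilbertTensor (WeightedBergman n α) E) := fun F => rfl
  have hcoord : ∀ j F, W (mulOp _ (isHilbertModule_bergman j) F) =
      mulOp _ (isHilbertModule_bergman j) (W F) := fun j F => by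
    have h3 : U.symm (mulOp _ (h₂ j) F) = mulOp _ (h₁ j) (U.symm F) := by
      rw [LinearIsometryEquiv.symm_apply_eq, hU, LinearIsometryEquiv.apply_symm_apply]
    refine RKHS.ext fun x => ?_
    rw [hW, h3, ← submodule_coe_apply, mulOp_apply, mulOp_apply, hW, submodule_coe_apply]
  obtain ⟨φ, hφ, hφW⟩ := exists_symbol_of_commute hα (T := W.toContinuousLinearMap) W.norm_map
    fun w F => by
      change W _ = innerMul α E w (W F)
      rw [innerMul_eq_sum, innerMul_eq_sum, map_sum]
      exact Finset.sum_congr rfl fun j _ => by rw [map_smul, hcoord]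
  have hM : IsMultiplier (HilbertTensor (WeightedBergman n α) E) (fun z : UnitBall n => φ z) :=
    fun F => ⟨W F, fun x => hφW F x⟩
  have hMW : ∀ F, mulOp _ hM F = W F := fun F => RKHS.ext fun x => by
    rw [mulOp_apply]
    exact (hφW F x).symm
  have hI : Isometry (mulOp _ hM) :=
    AddMonoidHomClass.isometry_of_norm _ fun F => by rw [hMW, W.norm_map]
  obtain ⟨V, hV, hVM⟩ := (isometry_mulOp_iff hφ hM).1 hI
  refine ⟨V, hV, ?_⟩
  have hVW : ∀ F, idTensorIsometry hV F = W F := fun F => by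
    rw [← hMW, hVM]
    rfl
  ext F
  constructor
  · intro hF
    refine ⟨U ⟨F, hF⟩, (hVW _).trans ?_⟩
    rw [hW, LinearIsometryEquiv.symm_apply_apply]
  · rintro ⟨G, rfl⟩
    change idTensorIsometry hV G ∈ S
    rw [hVW, hW]
    exact (U.symm G).2

/-- I ⊗ V acts by V at each point, so it commutes with multiplication by the scalar coordinates; the
required unitary is its inverse on the range. -/
theorem unitarilyEquivalent_of_isometry
    {S : Submodule ℂ (HilbertTensor (WeightedBergman n α) E)} (hS : IsHilbertModule S)
    {V : E →L[ℂ] E} (hV : Isometry V)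
    (h : LinearMap.range (idTensorIsometry (H := WeightedBergman n α) hV).toLinearMap = S) :
    UnitarilyEquivalent S (HilbertTensor (WeightedBergman n α) E) := by
  let U : HilbertTensor (WeightedBergman n α) E ≃ₗᵢ[ℂ] S :=
    (idTensorIsometry (H := WeightedBergman n α) hV).equivRange.trans
      (LinearIsometryEquiv.ofEq _ _ h)
  have hU : ∀ F, (U F : HilbertTensor (WeightedBergman n α) E) = idTensor _ V F := fun F => rfl
  refine ⟨hS, isHilbertModule_bergman, U.symm, fun j F => ?_⟩
  rw [LinearIsometryEquiv.symm_apply_eq]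
  obtain ⟨G, rfl⟩ := U.surjective F
  rw [LinearIsometryEquiv.symm_apply_apply]
  refine RKHS.ext fun x => ?_
  rw [mulOp_apply, submodule_coe_apply, submodule_coe_apply, hU, hU, idTensor_apply,
    idTensor_apply, mulOp_apply]
  simp [coordFun]

end MainResult

theorem mainTheorem7 (n : ℕ) (α : ℝ) [Fact ((n : ℝ) < α)]
    {E : Type*} [NormedAddCommGroup E] [InnerProductSpace ℂ E] [CompleteSpace E]
    (φ : EuclideanSpace ℂ (Fin n) → E →L[ℂ] E) (hφ : IsBoundedHolomorphic φ)
    (S : Submodule ℂ (HilbertTensor (WeightedBergman n α) E)) (hS : IsHilbertSubmodule S) :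
    (∃ hM : IsMultiplier (HilbertTensor (WeightedBergman n α) E) (fun z : UnitBall n => φ z),
      Isometry (mulOp _ hM) ↔
        ∃ V : E →L[ℂ] E, Isometry V ∧ mulOp _ hM = idTensor (WeightedBergman n α) V) ∧
    (UnitarilyEquivalent S (HilbertTensor (WeightedBergman n α) E) ↔
      ∃ E' : Submodule ℂ E, IsClosed (E' : Set E) ∧ Nonempty (E ≃ₗᵢ[ℂ] E') ∧
        S = tensorSubspace (WeightedBergman n α) E') := by
  refine ⟨⟨isMultiplier_of_bounded hφ, isometry_mulOp_iff hφ _⟩, fun h => ?_, ?_⟩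
  · obtain ⟨V, hV, hSV⟩ := exists_isometry_of_unitarilyEquivalent h
    let W : E →ₗᵢ[ℂ] E := ⟨V, (AddMonoidHomClass.isometry_iff_norm _).1 hV⟩
    refine ⟨LinearMap.range (V : E →ₗ[ℂ] E), ?_, ⟨W.equivRange⟩, ?_⟩
    · have hcl := hV.isClosedEmbedding.isClosed_range
      exact hcl
    · rw [hSV, range_idTensorIsometry]
  · rintro ⟨E', -, ⟨J⟩, hSE⟩
    -- The isometry V is the identification of E with E' followed by the inclusion, so its range is
    -- E'.
    let W : E →ₗᵢ[ℂ] E := E'.subtypeₗᵢ.comp J.toLinearIsometry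
    have hV : Isometry W.toContinuousLinearMap := W.isometry
    have hr : LinearMap.range (W.toContinuousLinearMap : E →ₗ[ℂ] E) = E' := by
      ext η
      constructor
      · rintro ⟨ξ, rfl⟩
        exact (J ξ).2
      · intro hη
        exact ⟨J.symm ⟨η, hη⟩, congrArg Subtype.val (J.apply_symm_apply ⟨η, hη⟩)⟩
    refine unitarilyEquivalent_of_isometry hS.2 hV ?_
    rw [range_idTensorIsometry, hr, hSE]
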